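/- **Theorem 3.1.** Let $L,\nu,\alpha,\beta,h,c_1,c_2>0$, $\eta\in\mathbb R$, $\Omega=[0,L]^3$ with periodic boundary conditions, $\lambda_1=4\pi^2/L^2$, and let $\|\cdot\|$ be the norm of $L^2(\Omega;\mathbb R^3)$. Write $\hat u_K$ ($K\in\mathbb Z^3$) for the Fourier coefficients of $u$ with respect to $e^{2\pi iK\cdot x/L}$. For $s\ge 0$ let $V_s$ be the space of real fields $u\in L^2(\Omega;\mathbb R^3)$ with $\hat u_0=0$, $K\cdot\hat u_K=0$ for all $K$ and $\sum_K|K|^{2s}|\hat u_K|^2<\infty$, and put $H=V_0$, $V=V_1$, $D(A)=V_2$. Let $\mathcal P$ be the Helmholtz–Leray projection onto mean-free divergence-free fields, $A=-\mathcal P\Delta$ (on Fourier coefficients: multiplication by $4\pi^2|K|^2/L^2$), $B(u,v)=\mathcal P[(u\cdot\nabla)v]$, so that $\|\nabla u\|^2=L^3\sum_K\frac{4\pi^2|K|^2}{L^2}|\hat u_K|^2$ on $V$. Let $c>0$ be a constant such that $$\|g\|_{L^3}\le c\|g\|^{1/2}\|\nabla g\|^{1/2},\qquad \|g\|_{L^4}\le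 c\|g\|^{1/4}\|\nabla g\|^{3/4},\qquad \|g\|_{L^6}\le c\|\nabla g\|\qquad\text{for all } g\in V .$$ Let $f\in L^\infty(0,\infty;H)$, and write $\sup_{s\ge0}\|f(s)\|$ for its (essential) supremum. Let $I_h$ be a linear operator from $D(A)$ to $L^2(\Omega;\mathbb R^3)$ such that $$\|I_h\varphi-\varphi\|^2\le c_1h^2\|\nabla\varphi\|^2+c_2h^4\|\Delta\varphi\|^2\qquad\text{for all }\varphi\in D(A).$$ Let $u_0,w_0\in V$, let $u$ be a global solution of the simplified Bardina model $$\frac{dv}{dt}+\nu Av+B(u,u)=f,\qquad v=u+\alpha^2Au,\qquad u(0)=u_0,$$ and let $w$ be a global solution of the assimilated system $$\frac{dz}{dt}+\nu Az+B(w,w)=f-\eta\,\mathcal P(I_hw-I_hu),\qquad z=w+\beta^2Aw,\qquad w(0)=w_0 .$$ Here a global solution is such that $u,w\in C([0,T];V)\cap L^2(0,T;D(A))$ and $\frac{du}{dt},\frac{dw}{dt}\in L^2(0,T;H)$ for every $T>0$, and the equations hold in the dual of $D(A)$ for almost every $t\ge0$. Put $$M_1=\|u_0\|^2+\alpha^2\|\nabla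 u_0\|^2+\frac1{\lambda_1^2\nu^2}\sup_{s\ge0}\|f(s)\|^2,$$ $$M_2=\frac{7M_1}{\alpha^2}+\frac{81}{256}\,\frac{c^{16}M_1^5}{\nu^8\alpha^8\lambda_1}+\Big(\frac1{\nu^2\lambda_1}+\frac3{\nu^2\lambda_1^2\alpha^2}\Big)\sup_{s\ge0}\|f(s)\|^2 .$$ Suppose that 1. $\displaystyle \eta>\frac{27c^4}{16}\Big(\frac3\nu\Big)^3\frac{M_1^2}{\alpha^4}$; 2. $2\eta c_1h^2<\nu$ and $2\eta c_2h^4<\nu\beta^2$. Then $g(t)=w(t)-u(t)$ satisfies, for all $t\ge0$, $$\|g(t)\|^2+\beta^2\|\nabla g(t)\|^2\le e^{-\frac{\lambda_1\nu}2t}\big(\|g(0)\|^2+\beta^2\|\nabla g(0)\|^2\big)+\frac{2e}{e^{1/2}-1}\cdot\frac{|\beta^2-\alpha^2|^2}{\beta^2}\,M_2 .$$ -/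

import Mathlib

open MeasureTheory Filter Topology

namespace Bardina

noncomputable section

/-- The periodic cell `Ω = [0, L]³`. -/
def box (L : ℝ) : Set (Fin 3 → ℝ) := Set.Icc 0 (fun _ => L)

/-- The space `L²(Ω; ℝ³)` of real vector fields; its norm is the usual `L²` norm `‖u‖`. -/
abbrev L2 (L : ℝ) : Type :=
  Lp (EuclideanSpace ℝ (Fin 3)) 2 ((volume : Measure (Fin 3 → ℝ)).restrict (box L))

/-- Sequences `(û_K)` of vector Fourier coefficients, `K ∈ ℤ³`. Elements of the spaces of negative
order (such as the dual of `D(A)`) are identified with their coefficient sequences. -/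
abbrev Coeffs : Type := (Fin 3 → ℤ) → Fin 3 → ℂ

/-- The exponential `x ↦ exp (2 π i K · x / L)`. -/
def wave (L : ℝ) (K : Fin 3 → ℤ) (x : Fin 3 → ℝ) : ℂ :=
  Complex.exp (2 * Real.pi * Complex.I * (∑ i, (K i : ℂ) * (x i : ℂ)) / L)

/-- The Fourier coefficients `û_K = L⁻³ ∫_Ω u(x) exp (-2 π i K · x / L) dx` of a field. They
satisfy `û_{-K} = conj û_K` because `u` is real. -/
def coeff {L : ℝ} (u : L2 L) : Coeffs := fun K j =>
  (1 / (L : ℂ) ^ 3) *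
    ∫ x in box L, (starRingEnd ℂ) (wave L K x) * ((u x j : ℝ) : ℂ)

/-- `|K|²`. -/
def freqSq (K : Fin 3 → ℤ) : ℝ := ∑ i, (K i : ℝ) ^ 2

/-- The eigenvalue `4 π² |K|² / L²` of `A = -Δ` at the frequency `K`. -/
def eigen (L : ℝ) (K : Fin 3 → ℤ) : ℝ := 4 * Real.pi ^ 2 * freqSq K / L ^ 2

/-- Membership in the space `V_s` of mean-free, divergence-free fields with
`∑ |K|^{2s} |û_K|² < ∞`. Thus `H = V_0`, `V = V_1` and `D(A) = V_2`. -/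
structure MemV (L : ℝ) (s : ℕ) (u : L2 L) : Prop where
  mean_zero : ∀ j, coeff u 0 j = 0
  div_free : ∀ K, ∑ j, (K j : ℂ) * coeff u K j = 0
  summable : Summable fun K => freqSq K ^ s * ∑ j, ‖coeff u K j‖ ^ 2

/-- The norm of order `s`, `(L³ ∑ (2 π |K| / L)^{2s} |û_K|²)^{1/2}`. On `V` the value for `s = 1`
is `‖∇u‖`, and on `D(A)` the value for `s = 2` is `‖Au‖ = ‖Δu‖`. -/
def hNorm {L : ℝ} (s : ℕ) (u : L2 L) : ℝ :=
  Real.sqrt (L ^ 3 * ∑' K, eigen L K ^ s * ∑ j, ‖coeff u K j‖ ^ 2)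

/-- The first eigenvalue `λ₁ = 4 π² / L²` of `A`. -/
def lam1 (L : ℝ) : ℝ := 4 * Real.pi ^ 2 / L ^ 2

/-- The Helmholtz-Leray projection on Fourier coefficients (it also removes the mean). -/
def leray (a : Coeffs) : Coeffs := fun K j =>
  if K = 0 then 0 else a K j - (K j : ℂ) * (∑ i, a K i * (K i : ℂ)) / (freqSq K : ℂ)

/-- The operator `A = -Δ` on Fourier coefficients. -/
def stokes (L : ℝ) (a : Coeffs) : Coeffs := fun K j => (eigen L K : ℂ) * a K j

/-- The operator `I + α² A` on Fourier coefficients. -/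
def helmholtz (L α : ℝ) (a : Coeffs) : Coeffs := fun K j =>
  a K j + (α : ℂ) ^ 2 * stokes L a K j

/-- The Fourier coefficients of `(u · ∇) v`, from the product of the Fourier series
of `u` and `∇v`. The series converges absolutely as soon as `u ∈ H` and `v ∈ V`. -/
def advect {L : ℝ} (u v : L2 L) : Coeffs := fun K j =>
  ∑' J : Fin 3 → ℤ,
    (∑ i, coeff u (K - J) i * (2 * Real.pi * Complex.I * (J i : ℂ) / L)) * coeff v J j

/-- `B(u, v) = 𝒫 [(u · ∇) v]`. -/
def bilin {L : ℝ} (u v : L2 L) : Coeffs := leray (advect u v)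

/-- The regularity class of global solutions: `u ∈ C([0,T]; V) ∩ L²(0,T; D(A))` and
`u' = du/dt ∈ L²(0,T; H)` for every `T > 0`. -/
structure IsRegular {L : ℝ} (u u' : ℝ → L2 L) : Prop where
  mem_V : ∀ t, 0 ≤ t → MemV L 1 (u t)
  continuous_V : ∀ t₀, 0 ≤ t₀ →
    Tendsto (fun t => hNorm 1 (u t - u t₀)) (𝓝[Set.Ici 0] t₀) (𝓝 0)
  mem_DA : ∀ᵐ t ∂(volume.restrict (Set.Ici (0 : ℝ))), MemV L 2 (u t)
  integrable_DA : ∀ T, 0 < T → IntegrableOn (fun t => hNorm 2 (u t) ^ 2) (Set.Icc 0 T)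
  deriv_mem_H : ∀ᵐ t ∂(volume.restrict (Set.Ici (0 : ℝ))), MemV L 0 (u' t)
  deriv_memLp : ∀ T, 0 < T → MemLp u' 2 (volume.restrict (Set.Icc 0 T))
  eq_integral : ∀ t, 0 ≤ t → u t = u 0 + ∫ s in (0 : ℝ)..t, u' s

/-- Global solutions of the simplified Bardina model
`dv/dt + ν A v + B(u, u) = f`, `v = u + α² A u`, `u(0) = u₀`;
the equation is an identity in the dual of `D(A)` for almost every `t ≥ 0`. -/
def IsBardinaSolution {L : ℝ} (ν α : ℝ) (f : ℝ → L2 L) (u₀ : L2 L) (u : ℝ → L2 L) : Prop :=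
  u 0 = u₀ ∧ ∃ u' : ℝ → L2 L, IsRegular u u' ∧
    ∀ᵐ t ∂(volume.restrict (Set.Ici (0 : ℝ))),
      helmholtz L α (coeff (u' t)) + (ν : ℂ) • stokes L (helmholtz L α (coeff (u t)))
        + bilin (u t) (u t) = coeff (f t)

/-- Global solutions of the nudged system
`dz/dt + ν A z + B(w, w) = f - η 𝒫 (I_h w - I_h u)`, `z = w + β² A w`, `w(0) = w₀`. -/
def IsNudgedSolution {L : ℝ} (ν β η : ℝ) (f : ℝ → L2 L) (Ih : L2 L →ₗ[ℝ] L2 L)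
    (u : ℝ → L2 L) (w₀ : L2 L) (w : ℝ → L2 L) : Prop :=
  w 0 = w₀ ∧ ∃ w' : ℝ → L2 L, IsRegular w w' ∧
    ∀ᵐ t ∂(volume.restrict (Set.Ici (0 : ℝ))),
      helmholtz L β (coeff (w' t)) + (ν : ℂ) • stokes L (helmholtz L β (coeff (w t)))
        + bilin (w t) (w t)
        = coeff (f t) - (η : ℂ) • leray (coeff (Ih (w t) - Ih (u t)))

/-- The approximation-of-identity property of the interpolant at resolution `h`,
`‖I_h φ - φ‖² ≤ c₁ h² ‖∇φ‖² + c₂ h⁴ ‖Δφ‖²` for `φ ∈ D(A)`. Only the values of `I_h` on `D(A)`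
matter: its values on the rest of `L²` (to which any linear map on `D(A)` extends)
are unconstrained, and no boundedness on `L²` is asked for. -/
def IsInterpolant {L : ℝ} (h c₁ c₂ : ℝ) (Ih : L2 L →ₗ[ℝ] L2 L) : Prop :=
  ∀ φ : L2 L, MemV L 2 φ →
    ‖Ih φ - φ‖ ^ 2 ≤ c₁ * h ^ 2 * hNorm 1 φ ^ 2 + c₂ * h ^ 4 * hNorm 2 φ ^ 2

/-- `c` is a constant for which the Gagliardo-Nirenberg inequalities
`‖g‖_{L³} ≤ c ‖g‖^{1/2} ‖∇g‖^{1/2}`, `‖g‖_{L⁴} ≤ c ‖g‖^{1/4} ‖∇g‖^{3/4}`,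
`‖g‖_{L⁶} ≤ c ‖∇g‖` hold on `V`. -/
def IsGNConstant (L c : ℝ) : Prop :=
  ∀ g : L2 L, MemV L 1 g →
    eLpNorm g 3 (volume.restrict (box L)) ≤
      ENNReal.ofReal (c * ‖g‖ ^ (1 / 2 : ℝ) * hNorm 1 g ^ (1 / 2 : ℝ)) ∧
    eLpNorm g 4 (volume.restrict (box L)) ≤
      ENNReal.ofReal (c * ‖g‖ ^ (1 / 4 : ℝ) * hNorm 1 g ^ (3 / 4 : ℝ)) ∧
    eLpNorm g 6 (volume.restrict (box L)) ≤ ENNReal.ofReal (c * hNorm 1 g)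

/-- `f ∈ L^∞(0, ∞; H)`. -/
def IsForcing {L : ℝ} (f : ℝ → L2 L) : Prop :=
  MemLp f ⊤ (volume.restrict (Set.Ici (0 : ℝ))) ∧
    ∀ᵐ t ∂(volume.restrict (Set.Ici (0 : ℝ))), MemV L 0 (f t)

/-- `sup_{s ≥ 0} ‖f(s)‖²`, the (essential) supremum of the class `f ∈ L^∞(0, ∞; H)`. -/
def supSq {L : ℝ} (f : ℝ → L2 L) : ℝ :=
  (eLpNorm f ⊤ (volume.restrict (Set.Ici (0 : ℝ)))).toReal ^ 2

/-- `M₁ = ‖u₀‖² + α² ‖∇u₀‖² + sup ‖f‖² / (λ₁² ν²)`. -/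
def M1 {L : ℝ} (ν α : ℝ) (f : ℝ → L2 L) (u₀ : L2 L) : ℝ :=
  ‖u₀‖ ^ 2 + α ^ 2 * hNorm 1 u₀ ^ 2 + 1 / (lam1 L ^ 2 * ν ^ 2) * supSq f

/-- `M₂ = 7 M₁ / α² + (81/256) c¹⁶ M₁⁵ / (ν⁸ α⁸ λ₁)
+ (1 / (ν² λ₁) + 3 / (ν² λ₁² α²)) sup ‖f‖²`. -/
def M2 {L : ℝ} (ν α c : ℝ) (f : ℝ → L2 L) (u₀ : L2 L) : ℝ :=
  7 * M1 ν α f u₀ / α ^ 2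
    + 81 / 256 * (c ^ 16 * M1 ν α f u₀ ^ 5 / (ν ^ 8 * α ^ 8 * lam1 L))
    + (1 / (ν ^ 2 * lam1 L) + 3 / (ν ^ 2 * lam1 L ^ 2 * α ^ 2)) * supSq f

end

end Bardina

open Bardina

/-!
The theorem compares two energy balances and closes with a single Grönwall inequality.

*Fourier side.* Fields are treated through their Fourier coefficients. Parseval's identity on the
cell (`hasSum_conj_fourierC_mul`) is transferred from the unit torus of Mathlib, and it yields that
products have convolutions as coefficients (`hasSum_fourierC_mul`). For divergence-free `u` the
coefficients of `(u · ∇) v` are those of `div (u ⊗ v)` (`MemV.advect_eq`). Fields of `D(A)` have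
absolutely summable Fourier series, so the double series for the trilinear form
`b(u, v, w) = ∫ (u · ∇) v · w` converges absolutely, `b(u, v, v) = 0` (`re_tsum_triTerm_self`) and
`|b(g, u, g)| ≤ ‖∇u‖ ‖g ⊗ g‖` (`norm_tsum_triTerm_le`).

*A priori bound.* Testing the Bardina model with `u` gives
`d/dt (‖u‖² + α² ‖∇u‖²) ≤ -ν (‖∇u‖² + α² ‖Δu‖²) + sup ‖f‖² / (ν λ₁)`, hence
`‖u‖² + α² ‖∇u‖² ≤ M₁` for all times (`bardina_energy_le`).

*Difference.* For `g = w - u` the mismatch of the two filters contributes the model error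
`(β² - α²) A (du/dt + ν A u)`. The equation for `u` turns it into
`(β² - α²) A (I + α² A)⁻¹ (f - B(u, u))`. After `A` is moved onto `g`, the operator
`(I + α² A)⁻¹` gains the derivative in `B(u, u) = 𝒫 div (u ⊗ u)`, since `2 α λ^{1/2} ≤ 1 + α² λ`. So
the model error is controlled by `‖f‖` and `‖u ⊗ u‖` alone, with no bound on `du/dt`
(`hasSum_energy_difference`). The trilinear term `b(g, u, g)` is absorbed by half of the viscosity
and half of the nudging (`trilinear_absorbed`), and the interpolation error of `I_h` by the smallness
of `h`.

*The constant.* If `‖g ⊗ g‖² ≤ κ ‖g‖ ‖∇g‖³` on `V` (`QuarticBound`), absorbing `b(g, u, g)` needs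
`κ² ≤ 27 c⁴`. The hypothesis on `c` provides `κ = c⁴`, which suffices if `c⁴ ≤ 27`. For larger `c`
the value `κ = 27` is used: the inequality holds with this constant on every periodic cell
(`quarticBound_twentySeven`). It is proved for trigonometric polynomials, for which `|P|⁴` at a
point is at most its mean plus half its variation along each of the three grid lines through the
point, and the three bounds are combined by the grid-lines lemma of the Gagliardo-Nirenberg-Sobolev
inequality.

*Conclusion.* The energies satisfy their differential inequalities in integrated form
(`energy_identity`). The part of `‖u ⊗ u‖²` that is not bounded by a constant is a multiple of
`‖∇u‖²`; it is absorbed by the dissipation of `u` on adding `(β² - α²)² / β² · 3 / (4 α²)` times the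
energy of `u` to that of `g`. Grönwall's inequality (`gronwall_of_integral`) for the sum gives
the claim, because `2 e / (e^{1/2} - 1) ≥ 4`.
-/

namespace Bardina

noncomputable section

/-! ### Fourier series on the periodic cell -/

/-- The scalar Fourier coefficient `L⁻³ ∫_Ω φ(x) exp (-2 π i K · x / L) dx`. -/
def fourierC (L : ℝ) (φ : (Fin 3 → ℝ) → ℂ) (K : Fin 3 → ℤ) : ℂ :=
  (1 / (L : ℂ) ^ 3) * ∫ x in box L, (starRingEnd ℂ) (wave L K x) * φ x

section Torus

attribute [local instance] instMeasureSpaceUnitAddCircle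

/-- The point of `(0, L]³` that represents a point of the unit torus. -/
def torusRep (L : ℝ) (y : UnitAddTorus (Fin 3)) : Fin 3 → ℝ :=
  L • (UnitAddTorus.measurableEquivPiIoc (fun _ => (0 : ℝ)) y).1

/-- The uniform measure on the unit torus corresponds to the normalized Lebesgue measure on the
cell: the cubes `(0, L]³` and `[0, L]³` differ by a null set. -/
theorem measurePreserving_torusRep {L : ℝ} (hL : 0 < L) :
    MeasurePreserving (torusRep L) volume
      (ENNReal.ofReal (L ^ 3)⁻¹ • (volume : Measure (Fin 3 → ℝ)).restrict (box L)) := by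
  have h1 := UnitAddTorus.measurePreserving_equivPiIoc (d := Fin 3) (fun _ => (0 : ℝ))
  have hm : MeasurableSet {x : Fin 3 → ℝ | ∀ i, x i ∈ Set.Ioc (0 : ℝ) (0 + 1)} :=
    MeasurableSet.univ_pi' (fun i => measurableSet_Ioc)
  have h2 := measurePreserving_subtype_coe (μa := (volume : Measure (Fin 3 → ℝ))) hm
  have h3 : MeasurePreserving (fun x : Fin 3 → ℝ => L • x) volume
      (ENNReal.ofReal (L ^ 3)⁻¹ • (volume : Measure (Fin 3 → ℝ))) := by
    refine ⟨by fun_prop, ?_⟩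
    rw [Measure.map_addHaar_smul _ hL.ne']
    congr 2
    rw [abs_of_pos (by positivity)]
    simp
  have hm' : MeasurableSet (Set.univ.pi fun _ : Fin 3 => Set.Ioc (0 : ℝ) L) :=
    MeasurableSet.univ_pi (fun i => measurableSet_Ioc)
  have h4 := h3.restrict_preimage hm'
  have h5 : (fun x : Fin 3 → ℝ => L • x) ⁻¹' (Set.univ.pi fun _ : Fin 3 => Set.Ioc (0 : ℝ) L)
      = {x : Fin 3 → ℝ | ∀ i, x i ∈ Set.Ioc (0 : ℝ) (0 + 1)} := by
    ext x
    simp only [Set.mem_preimage, Set.mem_univ_pi, Pi.smul_apply, smul_eq_mul, Set.mem_Ioc,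
      Set.mem_ofPred_eq, zero_add]
    refine forall_congr' fun i => and_congr ?_ ?_
    · exact mul_pos_iff_of_pos_left hL
    · exact mul_le_iff_le_one_right hL
  rw [h5, Measure.restrict_smul] at h4
  have h6 : (volume : Measure (Fin 3 → ℝ)).restrict (Set.univ.pi fun _ : Fin 3 => Set.Ioc (0 : ℝ) L)
      = volume.restrict (box L) :=
    Measure.restrict_congr_set Measure.univ_pi_Ioc_ae_eq_Icc
  rw [h6] at h4
  exact h4.comp (h2.comp h1)

theorem mFourier_eq_wave {L : ℝ} (hL : 0 < L) (K : Fin 3 → ℤ) (y : UnitAddTorus (Fin 3)) :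
    UnitAddTorus.mFourier K y = wave L K (torusRep L y) := by
  have hy : ∀ i, y i = (((UnitAddTorus.measurableEquivPiIoc (fun _ => (0 : ℝ)) y).1 i : ℝ) :
      UnitAddCircle) := fun i => by
    simp only [UnitAddTorus.coe_measurableEquivPiIoc_apply]
    exact AddCircle.coe_equivIoc.symm
  have hL' : (L : ℂ) ≠ 0 := by exact_mod_cast hL.ne'
  simp only [UnitAddTorus.mFourier, ContinuousMap.coe_mk, wave, torusRep]
  rw [Finset.prod_congr rfl fun i _ => by rw [hy i, fourier_coe_apply], ← Complex.exp_sum]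
  congr 1
  rw [Finset.mul_sum, Finset.sum_div]
  refine Finset.sum_congr rfl fun i _ => ?_
  simp only [Pi.smul_apply, smul_eq_mul]
  push_cast
  field_simp

theorem integral_comp_torusRep {L : ℝ} (hL : 0 < L) {φ : (Fin 3 → ℝ) → ℂ}
    (hφ : AEStronglyMeasurable φ (volume.restrict (box L))) :
    ∫ y, φ (torusRep L y) = 1 / (L : ℂ) ^ 3 * ∫ x in box L, φ x := by
  have h := measurePreserving_torusRep hL
  have h1 : AEStronglyMeasurable φ (Measure.map (torusRep L) volume) := by
    rw [h.map_eq]; exact hφ.smul_measure _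
  rw [← integral_map h.measurable.aemeasurable h1, h.map_eq, integral_smul_measure,
    ENNReal.toReal_ofReal (by positivity)]
  rw [Complex.real_smul]
  push_cast
  rw [one_div]

theorem continuous_wave (L : ℝ) (K : Fin 3 → ℤ) : Continuous (wave L K) := by
  unfold wave
  fun_prop

theorem wave_neg (L : ℝ) (K : Fin 3 → ℤ) (x : Fin 3 → ℝ) :
    wave L (-K) x = (starRingEnd ℂ) (wave L K x) := by
  simp only [wave, ← Complex.exp_conj]
  congr 1
  simp [Finset.sum_neg_distrib, neg_mul, Complex.conj_ofNat]

theorem wave_add (L : ℝ) (K J : Fin 3 → ℤ) (x : Fin 3 → ℝ) :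
    wave L (K + J) x = wave L K x * wave L J x := by
  simp only [wave, ← Complex.exp_add]
  congr 1
  simp only [Pi.add_apply, Int.cast_add, add_mul, Finset.sum_add_distrib]
  ring

theorem norm_wave (L : ℝ) (K : Fin 3 → ℤ) (x : Fin 3 → ℝ) : ‖wave L K x‖ = 1 := by
  have : 2 * (Real.pi : ℂ) * Complex.I * (∑ i, (K i : ℂ) * (x i : ℂ)) / L
      = ((2 * Real.pi * (∑ i, (K i : ℝ) * x i) / L : ℝ) : ℂ) * Complex.I := by
    push_cast
    ring
  rw [wave, this, Complex.norm_exp_ofReal_mul_I]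

theorem mFourierCoeff_comp_torusRep {L : ℝ} (hL : 0 < L) {φ : (Fin 3 → ℝ) → ℂ}
    (hφ : AEStronglyMeasurable φ (volume.restrict (box L))) (K : Fin 3 → ℤ) :
    UnitAddTorus.mFourierCoeff (fun y => φ (torusRep L y)) K = fourierC L φ K := by
  unfold UnitAddTorus.mFourierCoeff fourierC
  simp only [smul_eq_mul, mFourier_eq_wave hL, wave_neg]
  exact integral_comp_torusRep hL (φ := fun x => (starRingEnd ℂ) (wave L K x) * φ x)
    ((Complex.continuous_conj.comp (continuous_wave L K)).aestronglyMeasurable.mul hφ)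

/-- Parseval's identity on the cell `Ω`. -/
theorem hasSum_conj_fourierC_mul {L : ℝ} (hL : 0 < L) {φ ψ : (Fin 3 → ℝ) → ℂ}
    (hφ : MemLp φ 2 (volume.restrict (box L))) (hψ : MemLp ψ 2 (volume.restrict (box L))) :
    HasSum (fun K => (starRingEnd ℂ) (fourierC L φ K) * fourierC L ψ K)
      (1 / (L : ℂ) ^ 3 * ∫ x in box L, (starRingEnd ℂ) (φ x) * ψ x) := by
  have h := measurePreserving_torusRep hL
  have aux : ∀ {θ : (Fin 3 → ℝ) → ℂ}, MemLp θ 2 (volume.restrict (box L)) →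
      MemLp (fun y => θ (torusRep L y)) 2 volume := fun hθ =>
    (hθ.smul_measure ENNReal.ofReal_ne_top).comp_measurePreserving h
  have key := UnitAddTorus.hasSum_prod_mFourierCoeff (aux hφ).toLp (aux hψ).toLp
  have e : ∀ {θ : (Fin 3 → ℝ) → ℂ} (hθ : MemLp θ 2 (volume.restrict (box L))) (K : Fin 3 → ℤ),
      UnitAddTorus.mFourierCoeff (aux hθ).toLp K = fourierC L θ K := fun hθ K => by
    rw [← mFourierCoeff_comp_torusRep hL hθ.1]
    unfold UnitAddTorus.mFourierCoeff
    refine integral_congr_ae ?_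
    filter_upwards [(aux hθ).coeFn_toLp] with y hy
    rw [hy]
  convert key using 1
  · funext K
    rw [← e hφ, ← e hψ]
  rw [← integral_comp_torusRep hL (φ := fun x => (starRingEnd ℂ) (φ x) * ψ x)
    (hφ.1.star.mul hψ.1)]
  refine integral_congr_ae ?_
  filter_upwards [(aux hφ).coeFn_toLp, (aux hψ).coeFn_toLp] with y h1 h2
  rw [h1, h2]

theorem fourierC_wave {L : ℝ} (hL : 0 < L) (K J : Fin 3 → ℤ) :
    fourierC L (wave L K) J = if K = J then 1 else 0 := by
  rw [← mFourierCoeff_comp_torusRep hL (continuous_wave L K).aestronglyMeasurable]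
  simp only [← mFourier_eq_wave hL]
  have h := orthonormal_iff_ite.mp (UnitAddTorus.orthonormal_mFourier (d := Fin 3)) J K
  rw [ContinuousMap.inner_toLp] at h
  unfold UnitAddTorus.mFourierCoeff
  simp only [UnitAddTorus.mFourier_neg, smul_eq_mul]
  rw [← if_congr (eq_comm (a := J) (b := K)) rfl rfl, ← h]
  refine integral_congr_ae (Eventually.of_forall fun y => ?_)
  simp [mul_comm]

end Torus

/-! ### Fourier coefficients of vector fields -/

variable {L : ℝ}

instance isFiniteMeasure_box (L : ℝ) :
    IsFiniteMeasure ((volume : Measure (Fin 3 → ℝ)).restrict (box L)) :=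
  ⟨by rw [Measure.restrict_apply_univ]; exact isCompact_Icc.measure_lt_top⟩

theorem integrable_conj_wave_mul {φ : (Fin 3 → ℝ) → ℂ}
    (hφ : Integrable φ (volume.restrict (box L))) (K : Fin 3 → ℤ) :
    Integrable (fun x => (starRingEnd ℂ) (wave L K x) * φ x) (volume.restrict (box L)) :=
  hφ.bdd_mul (c := 1) (Complex.continuous_conj.comp (continuous_wave L K)).aestronglyMeasurable
    (Eventually.of_forall fun x => by rw [RCLike.norm_conj, norm_wave])

theorem memLp_component (u : L2 L) (j : Fin 3) :
    MemLp (fun x => ((u x j : ℝ) : ℂ)) 2 (volume.restrict (box L)) := by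
  have h := Lp.memLp u
  refine MemLp.of_le h ?_ (Eventually.of_forall fun x => ?_)
  · have h2 : Continuous fun y : EuclideanSpace ℝ (Fin 3) => ((y j : ℝ) : ℂ) := by fun_prop
    exact h2.comp_aestronglyMeasurable h.1
  · rw [Complex.norm_real]
    exact PiLp.norm_apply_le (u x) j

theorem coeff_eq_fourierC (u : L2 L) (K : Fin 3 → ℤ) (j : Fin 3) :
    coeff u K j = fourierC L (fun x => ((u x j : ℝ) : ℂ)) K := rfl

theorem fourierC_congr {φ ψ : (Fin 3 → ℝ) → ℂ} (h : φ =ᵐ[volume.restrict (box L)] ψ)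
    (K : Fin 3 → ℤ) : fourierC L φ K = fourierC L ψ K := by
  unfold fourierC
  congr 1
  refine integral_congr_ae ?_
  filter_upwards [h] with x hx
  rw [hx]

theorem fourierC_add {φ ψ : (Fin 3 → ℝ) → ℂ} (hφ : Integrable φ (volume.restrict (box L)))
    (hψ : Integrable ψ (volume.restrict (box L))) (K : Fin 3 → ℤ) :
    fourierC L (fun x => φ x + ψ x) K = fourierC L φ K + fourierC L ψ K := by
  unfold fourierC
  rw [← mul_add, ← integral_add (integrable_conj_wave_mul hφ K) (integrable_conj_wave_mul hψ K)]
  simp only [mul_add]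

theorem fourierC_const_mul (a : ℂ) (φ : (Fin 3 → ℝ) → ℂ) (K : Fin 3 → ℤ) :
    fourierC L (fun x => a * φ x) K = a * fourierC L φ K := by
  unfold fourierC
  simp only [← integral_const_mul]
  refine integral_congr_ae (Eventually.of_forall fun x => ?_)
  simp only
  ring

theorem coeff_add (u v : L2 L) (K : Fin 3 → ℤ) (j : Fin 3) :
    coeff (u + v) K j = coeff u K j + coeff v K j := by
  simp only [coeff_eq_fourierC]
  rw [← fourierC_add ((memLp_component u j).integrable (by norm_num))
    ((memLp_component v j).integrable (by norm_num))]
  refine fourierC_congr ?_ K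
  filter_upwards [Lp.coeFn_add u v] with x hx
  rw [hx]
  simp

theorem coeff_smul (a : ℝ) (u : L2 L) (K : Fin 3 → ℤ) (j : Fin 3) :
    coeff (a • u) K j = a * coeff u K j := by
  simp only [coeff_eq_fourierC]
  rw [← fourierC_const_mul]
  refine fourierC_congr ?_ K
  filter_upwards [Lp.coeFn_smul a u] with x hx
  rw [hx]
  simp

theorem coeff_sub (u v : L2 L) (K : Fin 3 → ℤ) (j : Fin 3) :
    coeff (u - v) K j = coeff u K j - coeff v K j := by
  have h := coeff_add (u - v) v K j
  rw [sub_add_cancel] at h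
  rw [h, add_sub_cancel_right]

theorem coeff_neg_freq (u : L2 L) (K : Fin 3 → ℤ) (j : Fin 3) :
    coeff u (-K) j = (starRingEnd ℂ) (coeff u K j) := by
  simp only [coeff, map_mul, ← integral_conj, wave_neg, Complex.conj_ofReal]
  simp

/-- Parseval's identity for the inner product of two fields. -/
theorem hasSum_conj_coeff_mul (hL : 0 < L) (u v : L2 L) :
    HasSum (fun K => ∑ j, (starRingEnd ℂ) (coeff u K j) * coeff v K j)
      (((inner ℝ u v / L ^ 3 : ℝ)) : ℂ) := by
  have h : ∀ j ∈ (Finset.univ : Finset (Fin 3)), _ := fun j _ =>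
    hasSum_conj_fourierC_mul hL (memLp_component u j) (memLp_component v j)
  have h2 := hasSum_sum h
  suffices e : (((inner ℝ u v / L ^ 3 : ℝ)) : ℂ) = _ by
    rw [e]
    exact h2
  rw [← Finset.mul_sum, L2.inner_def, ← integral_finsetSum]
  · push_cast
    rw [div_eq_inv_mul, one_div, ← integral_complex_ofReal]
    congr 1
    refine integral_congr_ae (Eventually.of_forall fun x => ?_)
    simp only [PiLp.inner_apply, Complex.conj_ofReal]
    push_cast
    refine Finset.sum_congr rfl fun i _ => ?_
    simp [mul_comm]
  · intro j _
    exact (memLp_component u j).star.integrable_mul (memLp_component v j)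

theorem hasSum_re_conj_coeff_mul (hL : 0 < L) (u v : L2 L) :
    HasSum (fun K => ∑ j, ((starRingEnd ℂ) (coeff u K j) * coeff v K j).re)
      (inner ℝ u v / L ^ 3) := by
  have h := Complex.hasSum_re (hasSum_conj_coeff_mul hL u v)
  simpa only [Complex.re_sum, Complex.ofReal_re] using h

theorem hasSum_normSq_coeff (hL : 0 < L) (u : L2 L) :
    HasSum (fun K => ∑ j, ‖coeff u K j‖ ^ 2) (‖u‖ ^ 2 / L ^ 3) := by
  have h := hasSum_re_conj_coeff_mul hL u u
  rw [real_inner_self_eq_norm_sq] at h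
  convert h using 3 with K j
  rw [← Complex.normSq_eq_conj_mul_self, Complex.ofReal_re, Complex.normSq_eq_norm_sq]

theorem norm_coeff_le (hL : 0 < L) (u : L2 L) (K : Fin 3 → ℤ) (j : Fin 3) :
    ‖coeff u K j‖ ≤ Real.sqrt (1 / L ^ 3) * ‖u‖ := by
  have h := hasSum_normSq_coeff hL u
  have h1 : ∑ j, ‖coeff u K j‖ ^ 2 ≤ ‖u‖ ^ 2 / L ^ 3 :=
    le_hasSum h K fun J _ => Finset.sum_nonneg fun i _ => sq_nonneg _
  have h2 : ‖coeff u K j‖ ^ 2 ≤ ∑ j, ‖coeff u K j‖ ^ 2 :=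
    Finset.single_le_sum (f := fun j => ‖coeff u K j‖ ^ 2) (fun i _ => sq_nonneg _)
      (Finset.mem_univ j)
  refine abs_le_of_sq_le_sq' ?_ (by positivity) |>.2
  rw [mul_pow, Real.sq_sqrt (by positivity)]
  calc _ ≤ _ := h2.trans h1
    _ = _ := by ring

/-- A Fourier coefficient as a continuous linear functional on `L²`. -/
def coeffL (hL : 0 < L) (K : Fin 3 → ℤ) (j : Fin 3) : L2 L →L[ℝ] ℂ :=
  LinearMap.mkContinuous
    { toFun := fun u => coeff u K j
      map_add' := fun u v => coeff_add u v K j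
      map_smul' := fun a u => by simpa using coeff_smul a u K j }
    (Real.sqrt (1 / L ^ 3)) fun u => norm_coeff_le hL u K j

/-- The Fourier coefficients of a product are the convolution of the Fourier coefficients. -/
theorem hasSum_fourierC_mul (hL : 0 < L) {φ ψ : (Fin 3 → ℝ) → ℂ}
    (hφ : MemLp φ 2 (volume.restrict (box L))) (hψ : MemLp ψ 2 (volume.restrict (box L)))
    (K : Fin 3 → ℤ) :
    HasSum (fun J => fourierC L φ (K - J) * fourierC L ψ J)
      (fourierC L (fun x => φ x * ψ x) K) := by
  have h1 : MemLp (fun x => wave L K x * (starRingEnd ℂ) (φ x)) 2 (volume.restrict (box L)) := by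
    refine MemLp.of_le hφ ((continuous_wave L K).aestronglyMeasurable.mul hφ.1.star)
      (Eventually.of_forall fun x => ?_)
    rw [norm_mul, norm_wave, one_mul, RCLike.norm_conj]
  convert hasSum_conj_fourierC_mul hL h1 hψ using 1
  · funext J
    congr 1
    unfold fourierC
    simp only [map_mul, ← integral_conj]
    congr 1
    · simp
    refine integral_congr_ae (Eventually.of_forall fun x => ?_)
    simp only [sub_eq_add_neg, wave_add, wave_neg, map_mul, Complex.conj_conj]
    ring
  · unfold fourierC
    congr 1
    refine integral_congr_ae (Eventually.of_forall fun x => ?_)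
    simp only [map_mul, Complex.conj_conj]
    ring

/-- The Fourier coefficients of the product `u_i v_j`. -/
def tensor (u v : L2 L) (i j : Fin 3) (K : Fin 3 → ℤ) : ℂ :=
  fourierC L (fun x => ((u x i : ℝ) : ℂ) * ((v x j : ℝ) : ℂ)) K

theorem hasSum_tensor (hL : 0 < L) (u v : L2 L) (i j : Fin 3) (K : Fin 3 → ℤ) :
    HasSum (fun J => coeff u (K - J) i * coeff v J j) (tensor u v i j K) :=
  hasSum_fourierC_mul hL (memLp_component u i) (memLp_component v j) K

/-- Parseval's identity for the squared modulus of a single function. -/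
theorem hasSum_normSq_fourierC (hL : 0 < L) {φ : (Fin 3 → ℝ) → ℂ}
    (hφ : MemLp φ 2 (volume.restrict (box L))) :
    HasSum (fun K => ‖fourierC L φ K‖ ^ 2) (1 / L ^ 3 * ∫ x in box L, ‖φ x‖ ^ 2) := by
  have h := Complex.hasSum_re (hasSum_conj_fourierC_mul hL hφ hφ)
  convert h using 1
  · funext K
    rw [← Complex.normSq_eq_conj_mul_self, Complex.ofReal_re, Complex.normSq_eq_norm_sq]
  · have : ∀ x, (starRingEnd ℂ) (φ x) * φ x = ((‖φ x‖ ^ 2 : ℝ) : ℂ) := fun x => by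
      rw [← Complex.normSq_eq_conj_mul_self, Complex.normSq_eq_norm_sq]
    simp only [this]
    rw [integral_complex_ofReal]
    have e : (1 / (L : ℂ) ^ 3) = ((1 / L ^ 3 : ℝ) : ℂ) := by push_cast; rfl
    rw [e, ← Complex.ofReal_mul, Complex.ofReal_re]

/-! ### The Gagliardo-Nirenberg inequality on the Fourier side -/

/-- `∑_{i,j} |(u_i u_j)^_K|²`, the square of the modulus of the Fourier coefficient of `u ⊗ u`. -/
def tensorSq (u : L2 L) (K : Fin 3 → ℤ) : ℝ := ∑ i, ∑ j, ‖tensor u u i j K‖ ^ 2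

theorem tensorSq_nonneg (u : L2 L) (K : Fin 3 → ℤ) : 0 ≤ tensorSq u K :=
  Finset.sum_nonneg fun _ _ => Finset.sum_nonneg fun _ _ => sq_nonneg _

/-- The inequality `‖u ⊗ u‖² ≤ κ ‖u‖ ‖∇u‖³` on `V`, a Ladyzhenskaya inequality phrased through
Fourier coefficients. -/
def QuarticBound (L κ : ℝ) : Prop :=
  ∀ g : L2 L, MemV L 1 g →
    Summable (tensorSq g) ∧ L ^ 3 * ∑' K, tensorSq g K ≤ κ * ‖g‖ * hNorm 1 g ^ 3

/-- `L³ ∑ |(u ⊗ u)^_K|² = ‖u‖_{L⁴}⁴`, by Parseval's identity for the products `u_i u_j`. -/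
theorem hasSum_tensorSq (hL : 0 < L) {u : L2 L} (hu : MemLp u 4 (volume.restrict (box L))) :
    HasSum (tensorSq u) (1 / L ^ 3 * ∫ x in box L, ‖u x‖ ^ 4) := by
  have hc : ∀ i, MemLp (fun x => ((u x i : ℝ) : ℂ)) 4 (volume.restrict (box L)) := fun i => by
    refine MemLp.of_le hu (memLp_component u i).1 (Eventually.of_forall fun x => ?_)
    rw [Complex.norm_real]
    exact PiLp.norm_apply_le (u x) i
  have hp : ∀ i j, MemLp (fun x => ((u x i : ℝ) : ℂ) * ((u x j : ℝ) : ℂ)) 2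
      (volume.restrict (box L)) := fun i j => by
    have : ENNReal.HolderTriple 4 4 2 := ⟨by
      rw [← two_mul]
      have : (4 : ENNReal) = 2 * 2 := by norm_num
      rw [this, ENNReal.mul_inv (by simp) (by simp), ← mul_assoc,
        ENNReal.mul_inv_cancel (by simp) (by simp), one_mul]⟩
    exact (hc j).mul (hc i)
  have h : ∀ i ∈ (Finset.univ : Finset (Fin 3)), _ := fun i _ =>
    hasSum_sum (s := Finset.univ) fun j _ => hasSum_normSq_fourierC hL (hp i j)
  have h2 := hasSum_sum h
  suffices e : (1 / L ^ 3 * ∫ x in box L, ‖u x‖ ^ 4) = _ by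
    rw [e]
    exact h2
  have hi : ∀ i j, Integrable (fun x => ‖((u x i : ℝ) : ℂ) * ((u x j : ℝ) : ℂ)‖ ^ 2)
      (volume.restrict (box L)) := fun i j => (hp i j).integrable_norm_pow (by norm_num)
  simp only [← Finset.mul_sum]
  rw [Finset.sum_congr rfl fun i _ => (integral_finsetSum Finset.univ fun j _ => hi i j).symm,
    ← integral_finsetSum Finset.univ fun i _ => integrable_finsetSum _ fun j _ => hi i j]
  congr 1
  refine integral_congr_ae (Eventually.of_forall fun x => ?_)
  have e : ‖u x‖ ^ 4 = (∑ i, u x i ^ 2) * (∑ j, u x j ^ 2) := by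
    rw [show ‖u x‖ ^ 4 = ‖u x‖ ^ 2 * ‖u x‖ ^ 2 by ring, EuclideanSpace.real_norm_sq_eq]
  simp only [e, Finset.sum_mul_sum, norm_mul, Complex.norm_real, mul_pow, Real.norm_eq_abs, sq_abs]

theorem integral_norm_pow_four_le {u : L2 L} {a : ℝ} (ha : 0 ≤ a)
    (h : eLpNorm u 4 (volume.restrict (box L)) ≤ ENNReal.ofReal a) :
    ∫ x in box L, ‖u x‖ ^ 4 ≤ a ^ 4 := by
  have hu : MemLp u 4 (volume.restrict (box L)) :=
    ⟨(Lp.memLp u).1, h.trans_lt ENNReal.ofReal_lt_top⟩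
  rw [hu.eLpNorm_eq_integral_rpow_norm (by norm_num) (by norm_num),
    ENNReal.ofReal_le_ofReal_iff ha] at h
  simp only [ENNReal.toReal_ofNat] at h
  have e : ∀ x, ‖u x‖ ^ (4 : ℝ) = ‖u x‖ ^ 4 := fun x => by norm_cast
  simp only [e] at h
  have h0 : 0 ≤ ∫ x in box L, ‖u x‖ ^ 4 := integral_nonneg fun x => by positivity
  calc ∫ x in box L, ‖u x‖ ^ 4 = ((∫ x in box L, ‖u x‖ ^ 4) ^ (4⁻¹ : ℝ)) ^ 4 := by
        rw [← Real.rpow_natCast, ← Real.rpow_mul h0]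
        norm_num
    _ ≤ a ^ 4 := pow_le_pow_left₀ (Real.rpow_nonneg h0 _) h 4

theorem hNorm_nonneg (s : ℕ) (u : L2 L) : 0 ≤ hNorm s u := Real.sqrt_nonneg _

/-- The `L⁴` inequality among the three that define `c` gives the quartic bound with `κ = c⁴`. -/
theorem IsGNConstant.quarticBound (hL : 0 < L) {c : ℝ} (hc : 0 < c) (h : IsGNConstant L c) :
    QuarticBound L (c ^ 4) := by
  intro g hg
  have h4 := (h g hg).2.1
  have hn := hNorm_nonneg 1 g
  have hu : MemLp g 4 (volume.restrict (box L)) :=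
    ⟨(Lp.memLp g).1, h4.trans_lt ENNReal.ofReal_lt_top⟩
  have hs := hasSum_tensorSq hL hu
  refine ⟨hs.summable, ?_⟩
  rw [hs.tsum_eq, ← mul_assoc, mul_one_div_cancel (by positivity), one_mul]
  refine (integral_norm_pow_four_le (by positivity) h4).trans_eq ?_
  rw [mul_pow, mul_pow, ← Real.rpow_natCast (‖g‖ ^ _), ← Real.rpow_mul (norm_nonneg g),
    ← Real.rpow_natCast (hNorm 1 g ^ _), ← Real.rpow_mul hn]
  norm_num

/-! ### Trigonometric polynomials -/

/-- The trigonometric polynomial with coefficients `a` and frequencies in `S`. -/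
def trig (L : ℝ) (S : Finset (Fin 3 → ℤ)) (a : (Fin 3 → ℤ) → ℂ) (x : Fin 3 → ℝ) : ℂ :=
  ∑ K ∈ S, a K * wave L K x

theorem continuous_trig (S : Finset (Fin 3 → ℤ)) (a : (Fin 3 → ℤ) → ℂ) :
    Continuous (trig L S a) :=
  continuous_finsetSum _ fun K _ => continuous_const.mul (continuous_wave L K)

theorem Continuous.memLp_box {φ : (Fin 3 → ℝ) → ℂ} (hφ : Continuous φ) (p : ENNReal) :
    MemLp φ p (volume.restrict (box L)) := by
  obtain ⟨C, hC⟩ := (isCompact_Icc (a := (0 : Fin 3 → ℝ)) (b := fun _ => L)).exists_bound_of_continuousOn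
    hφ.continuousOn
  exact MemLp.of_bound hφ.aestronglyMeasurable C
    ((ae_restrict_iff' measurableSet_Icc).2 (Eventually.of_forall hC))

theorem Continuous.integrable_box {φ : (Fin 3 → ℝ) → ℝ} (hφ : Continuous φ) :
    Integrable φ (volume.restrict (box L)) :=
  hφ.continuousOn.integrableOn_compact isCompact_Icc

/-- The exponential along a line parallel to an axis. -/
theorem wave_update (K : Fin 3 → ℤ) (x : Fin 3 → ℝ) (i : Fin 3) (s : ℝ) :
    wave L K (Function.update x i s)
      = wave L K (Function.update x i 0) * Complex.exp (2 * Real.pi * Complex.I * K i / L * s) := by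
  simp only [wave, ← Complex.exp_add]
  congr 1
  rw [← Finset.add_sum_erase _ _ (Finset.mem_univ i),
    ← Finset.add_sum_erase _ (fun j => (K j : ℂ) * ((Function.update x i 0 j : ℝ) : ℂ))
      (Finset.mem_univ i)]
  have : ∑ j ∈ Finset.univ.erase i, (K j : ℂ) * ((Function.update x i s j : ℝ) : ℂ)
      = ∑ j ∈ Finset.univ.erase i, (K j : ℂ) * ((Function.update x i 0 j : ℝ) : ℂ) :=
    Finset.sum_congr rfl fun j hj => by
      rw [Function.update_of_ne (Finset.ne_of_mem_erase hj),
        Function.update_of_ne (Finset.ne_of_mem_erase hj)]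
  rw [this]
  simp only [Function.update_self]
  push_cast
  ring

theorem hasDerivAt_trig_update (S : Finset (Fin 3 → ℤ)) (a : (Fin 3 → ℤ) → ℂ) (x : Fin 3 → ℝ)
    (i : Fin 3) (s : ℝ) :
    HasDerivAt (fun s : ℝ => trig L S a (Function.update x i s))
      (trig L S (fun K => a K * (2 * Real.pi * Complex.I * K i / L)) (Function.update x i s)) s := by
  unfold trig
  refine HasDerivAt.fun_sum fun K _ => ?_
  have h : HasDerivAt (fun s : ℝ => Complex.exp (2 * Real.pi * Complex.I * K i / L * s))
      (Complex.exp (2 * Real.pi * Complex.I * K i / L * s) *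
        (2 * Real.pi * Complex.I * K i / L)) s := by
    have h1 : HasDerivAt (fun s : ℝ => 2 * Real.pi * Complex.I * K i / L * (s : ℂ))
        (2 * Real.pi * Complex.I * K i / L * 1) s :=
      (Complex.ofRealCLM.hasDerivAt (x := s)).const_mul _
    simpa using h1.cexp
  have h2 := (h.const_mul (wave L K (Function.update x i 0))).const_mul (a K)
  simp only [← wave_update] at h2
  refine HasDerivAt.congr_deriv h2 ?_
  rw [wave_update K x i s]
  ring

theorem trig_update_period (hL : 0 < L) (S : Finset (Fin 3 → ℤ)) (a : (Fin 3 → ℤ) → ℂ)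
    (x : Fin 3 → ℝ) (i : Fin 3) :
    trig L S a (Function.update x i L) = trig L S a (Function.update x i 0) := by
  unfold trig
  refine Finset.sum_congr rfl fun K _ => ?_
  have hL' : (L : ℂ) ≠ 0 := by exact_mod_cast hL.ne'
  rw [wave_update]
  have : Complex.exp (2 * Real.pi * Complex.I * K i / L * L) = 1 := by
    rw [div_mul_cancel₀ _ hL', Complex.exp_eq_one_iff]
    exact ⟨K i, by ring⟩
  rw [this, mul_one]

theorem fourierC_trig (hL : 0 < L) (S : Finset (Fin 3 → ℤ)) (a : (Fin 3 → ℤ) → ℂ)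
    (K : Fin 3 → ℤ) : fourierC L (trig L S a) K = if K ∈ S then a K else 0 := by
  classical
  have h : ∀ S : Finset (Fin 3 → ℤ), fourierC L (trig L S a) K
      = ∑ J ∈ S, fourierC L (fun x => a J * wave L J x) K := by
    intro S
    induction S using Finset.induction_on with
    | empty => simp [trig, fourierC]
    | insert J T hJ ih =>
      rw [Finset.sum_insert hJ, ← ih, ← fourierC_add]
      · congr 1
        funext x
        simp [trig, Finset.sum_insert hJ]
      · exact ((continuous_const.mul (continuous_wave L J)).memLp_box 1).integrable le_rfl
      · exact ((continuous_trig T a).memLp_box 1).integrable le_rfl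
  rw [h S]
  simp only [fourierC_const_mul, fourierC_wave hL, mul_ite, mul_one, mul_zero]
  rw [Finset.sum_ite_eq' S K]

theorem integral_norm_sq_trig (hL : 0 < L) (S : Finset (Fin 3 → ℤ)) (a : (Fin 3 → ℤ) → ℂ) :
    ∫ x in box L, ‖trig L S a x‖ ^ 2 = L ^ 3 * ∑ K ∈ S, ‖a K‖ ^ 2 := by
  have h := hasSum_normSq_fourierC hL ((continuous_trig (L := L) S a).memLp_box 2)
  have h2 : HasSum (fun K => ‖fourierC L (trig L S a) K‖ ^ 2) (∑ K ∈ S, ‖a K‖ ^ 2) := by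
    have e : ∑ K ∈ S, ‖a K‖ ^ 2 = ∑ K ∈ S, ‖fourierC L (trig L S a) K‖ ^ 2 :=
      Finset.sum_congr rfl fun K hK => by rw [fourierC_trig hL, if_pos hK]
    rw [e]
    refine hasSum_sum_of_ne_finset_zero fun K hK => ?_
    rw [fourierC_trig hL, if_neg hK]
    simp
  rw [← h.unique h2]
  field_simp

/-- A periodic function of one variable is bounded by its mean plus half the total variation over a
period: of the two arcs that join two points of the circle, one carries at most half of it. -/
theorem le_mean_add_half_variation {h h' : ℝ → ℝ} (hL : 0 < L)
    (hd : ∀ s, HasDerivAt h (h' s) s) (hc : Continuous h') (hper : h L = h 0) {x : ℝ}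
    (hx : x ∈ Set.Icc 0 L) :
    h x ≤ (∫ s in (0 : ℝ)..L, h s) / L + (∫ s in (0 : ℝ)..L, |h' s|) / 2 := by
  have hci : ∀ a b, IntervalIntegrable h' volume a b := fun a b => hc.intervalIntegrable a b
  have hai : ∀ a b, IntervalIntegrable (fun s => |h' s|) volume a b := fun a b =>
    hc.abs.intervalIntegrable a b
  have ftc : ∀ a b, ∫ s in a..b, h' s = h b - h a := fun a b =>
    intervalIntegral.integral_eq_sub_of_hasDerivAt (fun s _ => hd s) (hci a b)
  have bd : ∀ a b, a ≤ b → |h b - h a| ≤ ∫ s in a..b, |h' s| := fun a b hab => by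
    rw [← ftc]
    exact intervalIntegral.abs_integral_le_integral_abs hab
  have key : ∀ a b, 0 ≤ a → a ≤ b → b ≤ L → 2 * |h b - h a| ≤ ∫ s in (0 : ℝ)..L, |h' s| := by
    intro a b ha hab hb
    have e1 := intervalIntegral.integral_add_adjacent_intervals (hai 0 a) (hai a b)
    have e2 := intervalIntegral.integral_add_adjacent_intervals (hai 0 b) (hai b L)
    have b1 := bd 0 a ha
    have b2 := bd a b hab
    have b3 := bd b L hb
    have : |h b - h a| ≤ |h a - h 0| + |h L - h b| := by
      rw [hper]
      calc |h b - h a| = |(h a - h 0) + (h 0 - h b)| := by rw [abs_sub_comm]; congr 1; ring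
        _ ≤ _ := abs_add_le _ _
    linarith
  have key2 : ∀ y ∈ Set.Icc 0 L, h x - (∫ s in (0 : ℝ)..L, |h' s|) / 2 ≤ h y := by
    intro y hy
    rcases le_total y x with hyx | hxy
    · have := key y x hy.1 hyx hx.2
      have := le_abs_self (h x - h y)
      linarith
    · have := key x y hx.1 hxy hy.2
      have := neg_abs_le (h y - h x)
      linarith
  have hcont : Continuous h := continuous_iff_continuousAt.2 fun s => (hd s).continuousAt
  have h3 := intervalIntegral.integral_mono_on hL.le (intervalIntegrable_const (μ := volume))
    (hcont.intervalIntegrable 0 L) key2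
  rw [intervalIntegral.integral_const, smul_eq_mul, sub_zero] at h3
  have h4 : h x - (∫ s in (0 : ℝ)..L, |h' s|) / 2 ≤ (∫ s in (0 : ℝ)..L, h s) / L := by
    rw [le_div_iff₀ hL]
    linarith
  linarith

/-! ### The grid-line inequality -/

theorem volume_restrict_box (L : ℝ) :
    (volume : Measure (Fin 3 → ℝ)).restrict (box L)
      = Measure.pi fun _ : Fin 3 => (volume : Measure ℝ).restrict (Set.Icc 0 L) := by
  rw [← Measure.restrict_pi_pi, ← volume_pi]
  congr 1
  exact (Set.pi_univ_Icc (0 : Fin 3 → ℝ) (fun _ => L)).symm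

/-- The Gagliardo grid-line inequality: a function whose square is dominated on every line parallel
to an axis by the integral of `f` along that line satisfies `‖k‖_{L³}⁶ ≤ ‖f‖_{L¹}³`. -/
theorem sq_integral_pow_three_le (hL : 0 < L) {k f : (Fin 3 → ℝ) → ℝ} (hk : Continuous k)
    (hf : Continuous f) (hk0 : ∀ x, 0 ≤ k x) (hf0 : ∀ x, 0 ≤ f x)
    (h : ∀ x ∈ box L, ∀ i, k x ^ 2 ≤ ∫ s in (0 : ℝ)..L, f (Function.update x i s)) :
    (∫ x in box L, k x ^ 3) ^ 2 ≤ (∫ x in box L, f x) ^ 3 := by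
  have hp : Real.HolderConjugate (Fintype.card (Fin 3)) (3 / 2 : ℝ) := by
    rw [Fintype.card_fin]
    exact Real.holderConjugate_iff.2 ⟨by norm_num, by norm_num⟩
  have key := lintegral_prod_lintegral_pow_le
    (fun _ : Fin 3 => (volume : Measure ℝ).restrict (Set.Icc 0 L)) hp
    (f := fun x => ENNReal.ofReal (f x)) (by fun_prop)
  rw [← volume_restrict_box] at key
  have hfc : ∀ (x : Fin 3 → ℝ) i, Continuous fun s : ℝ => f (Function.update x i s) := fun x i => by
    fun_prop
  have h1 : ∫⁻ x in box L, ENNReal.ofReal (k x ^ 3) ≤ (∫⁻ x in box L, ENNReal.ofReal (f x))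
      ^ (3 / 2 : ℝ) := by
    refine le_trans ?_ key
    refine lintegral_mono_ae ((ae_restrict_iff' measurableSet_Icc).2
      (Eventually.of_forall fun x hx => ?_))
    have h2 : ∀ i : Fin 3, ENNReal.ofReal (k x) ≤
        (∫⁻ s in Set.Icc 0 L, ENNReal.ofReal (f (Function.update x i s)))
          ^ (1 / ((Fintype.card (Fin 3) : ℝ) - 1)) := fun i => by
      rw [← ofReal_integral_eq_lintegral_ofReal
        ((hfc x i).continuousOn.integrableOn_compact isCompact_Icc)
        (Eventually.of_forall fun s => hf0 _), integral_Icc_eq_integral_Ioc,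
        ← intervalIntegral.integral_of_le hL.le]
      have h3 := h x hx i
      rw [ENNReal.ofReal_rpow_of_nonneg (le_trans (sq_nonneg _) h3) (by norm_num)]
      refine ENNReal.ofReal_le_ofReal ?_
      calc k x = (k x ^ 2) ^ (1 / ((Fintype.card (Fin 3) : ℝ) - 1)) := by
            rw [← Real.rpow_natCast, ← Real.rpow_mul (hk0 x)]
            norm_num
        _ ≤ _ := Real.rpow_le_rpow (sq_nonneg _) h3 (by norm_num)
    calc ENNReal.ofReal (k x ^ 3) = ∏ _i : Fin 3, ENNReal.ofReal (k x) := by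
          rw [Finset.prod_const, ENNReal.ofReal_pow (hk0 x)]
          rfl
      _ ≤ _ := Finset.prod_le_prod' fun i _ => h2 i
  have hk3 : Continuous fun x => k x ^ 3 := by fun_prop
  rw [← ofReal_integral_eq_lintegral_ofReal (Continuous.integrable_box hk3)
      (Eventually.of_forall fun s => pow_nonneg (hk0 s) 3),
    ← ofReal_integral_eq_lintegral_ofReal (Continuous.integrable_box hf)
      (Eventually.of_forall fun s => hf0 s),
    ENNReal.ofReal_rpow_of_nonneg (integral_nonneg hf0) (by norm_num),
    ENNReal.ofReal_le_ofReal_iff (Real.rpow_nonneg (integral_nonneg hf0) _)] at h1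
  calc (∫ x in box L, k x ^ 3) ^ 2 ≤ ((∫ x in box L, f x) ^ (3 / 2 : ℝ)) ^ 2 :=
        pow_le_pow_left₀ (integral_nonneg fun x => pow_nonneg (hk0 x) 3) h1 2
    _ = _ := by
        rw [← Real.rpow_natCast, ← Real.rpow_mul (integral_nonneg hf0), ← Real.rpow_natCast]
        norm_num

/-- The Cauchy-Schwarz inequality on the cell. -/
theorem sq_integral_mul_le {φ ψ : (Fin 3 → ℝ) → ℝ} (hφ : Continuous φ) (hψ : Continuous ψ) :
    (∫ x in box L, φ x * ψ x) ^ 2 ≤ (∫ x in box L, φ x ^ 2) * ∫ x in box L, ψ x ^ 2 := by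
  have i1 := Continuous.integrable_box (L := L) (φ := fun x => φ x ^ 2) (by fun_prop)
  have i2 := Continuous.integrable_box (L := L) (φ := fun x => ψ x ^ 2) (by fun_prop)
  have i3 := Continuous.integrable_box (L := L) (φ := fun x => φ x * ψ x) (by fun_prop)
  have h : ∀ t : ℝ, 0 ≤ (∫ x in box L, ψ x ^ 2) * (t * t) + (2 * ∫ x in box L, φ x * ψ x) * t
      + ∫ x in box L, φ x ^ 2 := fun t => by
    have : 0 ≤ ∫ x in box L, (φ x + t * ψ x) ^ 2 := integral_nonneg fun x => sq_nonneg _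
    have e : ∀ x, (φ x + t * ψ x) ^ 2 = φ x ^ 2 + (2 * t * (φ x * ψ x) + t ^ 2 * ψ x ^ 2) :=
      fun x => by ring
    simp only [e] at this
    rw [integral_add i1 (Continuous.integrable_box (by fun_prop)),
      integral_add (i3.const_mul _) (i2.const_mul _), integral_const_mul, integral_const_mul]
      at this
    linarith
  have := discrim_le_zero h
  rw [discrim] at this
  nlinarith

/-- A Ladyzhenskaya inequality in integrated form, for a density `N = |P|²` and a density `M`
that dominates the squared gradient of `P`. -/
theorem integral_sq_le_of_line_bound (hL : 0 < L) {N M : (Fin 3 → ℝ) → ℝ} (hN : Continuous N)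
    (hM : Continuous M) (hN0 : ∀ x, 0 ≤ N x) (hM0 : ∀ x, 0 ≤ M x) {n m : ℝ} (hn : 0 ≤ n)
    (hm : 0 ≤ m) (hNn : ∫ x in box L, N x = n ^ 2) (hMm : ∫ x in box L, M x = m ^ 2)
    (hnm : n ≤ L * m / 6)
    (h : ∀ x ∈ box L, ∀ i, N x ^ 2 ≤ ∫ s in (0 : ℝ)..L, (N (Function.update x i s) ^ 2 / L
      + 2 * (N (Function.update x i s) * Real.sqrt (N (Function.update x i s))
        * Real.sqrt (M (Function.update x i s))))) :
    ∫ x in box L, N x ^ 2 ≤ 27 * n * m ^ 3 := by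
  set I := ∫ x in box L, N x ^ 3 with hI
  set A := ∫ x in box L, N x ^ 2 with hA
  set B := ∫ x in box L, N x * Real.sqrt (N x) * Real.sqrt (M x) with hB
  have hI0 : 0 ≤ I := integral_nonneg fun x => pow_nonneg (hN0 x) 3
  have hA0 : 0 ≤ A := integral_nonneg fun x => sq_nonneg _
  have hB0 : 0 ≤ B := integral_nonneg fun x =>
    mul_nonneg (mul_nonneg (hN0 x) (Real.sqrt_nonneg _)) (Real.sqrt_nonneg _)
  have e1 : ∀ x, (N x * Real.sqrt (N x)) ^ 2 = N x ^ 3 := fun x => by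
    rw [mul_pow, Real.sq_sqrt (hN0 x)]; ring
  have e2 : ∀ x, Real.sqrt (N x) ^ 2 = N x := fun x => Real.sq_sqrt (hN0 x)
  have e3 : ∀ x, Real.sqrt (M x) ^ 2 = M x := fun x => Real.sq_sqrt (hM0 x)
  have e4 : ∀ x, N x * Real.sqrt (N x) * Real.sqrt (N x) = N x ^ 2 := fun x => by
    rw [mul_assoc, Real.mul_self_sqrt (hN0 x)]; ring
  have c1 : A ^ 2 ≤ I * n ^ 2 := by
    have := sq_integral_mul_le (L := L) (φ := fun x => N x * Real.sqrt (N x))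
      (ψ := fun x => Real.sqrt (N x)) (by fun_prop) (by fun_prop)
    simpa only [e1, e2, e4, hNn] using this
  have c2 : B ^ 2 ≤ I * m ^ 2 := by
    have := sq_integral_mul_le (L := L) (φ := fun x => N x * Real.sqrt (N x))
      (ψ := fun x => Real.sqrt (M x)) (by fun_prop) (by fun_prop)
    simpa only [e1, e3, hMm] using this
  have c3 : I ^ 2 ≤ (A / L + 2 * B) ^ 3 := by
    have := sq_integral_pow_three_le hL hN
      (f := fun x => N x ^ 2 / L + 2 * (N x * Real.sqrt (N x) * Real.sqrt (M x))) (by fun_prop) hN0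
      (fun x => add_nonneg (div_nonneg (sq_nonneg _) hL.le) (mul_nonneg zero_le_two
        (mul_nonneg (mul_nonneg (hN0 x) (Real.sqrt_nonneg _)) (Real.sqrt_nonneg _)))) h
    rw [integral_add, integral_div, integral_const_mul] at this
    · exact this
    · exact Continuous.integrable_box (φ := fun x => N x ^ 2 / L) (by fun_prop)
    · exact Continuous.integrable_box
        (φ := fun x => 2 * (N x * Real.sqrt (N x) * Real.sqrt (M x))) (by fun_prop)
  set r := Real.sqrt I with hr
  have hr0 : 0 ≤ r := Real.sqrt_nonneg _
  have hrI : I = r ^ 2 := (Real.sq_sqrt hI0).symm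
  have d1 : A ≤ r * n := abs_le_of_sq_le_sq' (by rw [mul_pow, ← hrI]; exact c1)
    (by positivity) |>.2
  have d2 : B ≤ r * m := abs_le_of_sq_le_sq' (by rw [mul_pow, ← hrI]; exact c2)
    (by positivity) |>.2
  have d3 : A / L + 2 * B ≤ r * (3 * m) := by
    have : A / L ≤ r * m / 6 := by
      rw [div_le_iff₀ hL]
      calc A ≤ r * n := d1
        _ ≤ r * (L * m / 6) := by gcongr
        _ = _ := by ring
    have := mul_nonneg hr0 hm
    linarith
  have d4 : r ^ 4 ≤ r ^ 3 * (3 * m) ^ 3 := by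
    calc r ^ 4 = I ^ 2 := by rw [hrI]; ring
      _ ≤ _ := c3
      _ ≤ (r * (3 * m)) ^ 3 := pow_le_pow_left₀ (by positivity) d3 3
      _ = _ := by ring
  have d5 : r ≤ 27 * m ^ 3 := by
    rcases hr0.eq_or_lt with h0 | h0
    · rw [← h0]; positivity
    · have : r ^ 3 * r ≤ r ^ 3 * (3 * m) ^ 3 := by linarith [d4]
      have := le_of_mul_le_mul_left this (by positivity)
      linarith
  calc A ≤ r * n := d1
    _ ≤ 27 * m ^ 3 * n := by gcongr
    _ = _ := by ring

/-! ### Sobolev norms, and the Ladyzhenskaya inequality for trigonometric polynomials -/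

theorem freqSq_nonneg (K : Fin 3 → ℤ) : 0 ≤ freqSq K := Finset.sum_nonneg fun _ _ => sq_nonneg _

theorem one_le_freqSq {K : Fin 3 → ℤ} (hK : K ≠ 0) : 1 ≤ freqSq K := by
  obtain ⟨i, hi⟩ := Function.ne_iff.1 hK
  have h1 : (1 : ℝ) ≤ (K i : ℝ) ^ 2 := by
    have : (1 : ℤ) ≤ K i ^ 2 := by have := sq_pos_of_ne_zero hi; exact this
    exact_mod_cast this
  exact h1.trans (Finset.single_le_sum (f := fun i => (K i : ℝ) ^ 2) (fun _ _ => sq_nonneg _)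
    (Finset.mem_univ i))

theorem eigen_nonneg (L : ℝ) (K : Fin 3 → ℤ) : 0 ≤ eigen L K :=
  div_nonneg (mul_nonneg (by positivity) (freqSq_nonneg K)) (sq_nonneg L)

theorem eigen_eq (L : ℝ) (K : Fin 3 → ℤ) : eigen L K = lam1 L * freqSq K := by
  unfold eigen lam1
  ring

theorem lam1_pos (hL : 0 < L) : 0 < lam1 L := by
  unfold lam1
  positivity

theorem lam1_le_eigen (hL : 0 < L) {K : Fin 3 → ℤ} (hK : K ≠ 0) : lam1 L ≤ eigen L K := by
  rw [eigen_eq]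
  exact le_mul_of_one_le_right (lam1_pos hL).le (one_le_freqSq hK)

/-- `|û_K|²`. -/
def amp (u : L2 L) (K : Fin 3 → ℤ) : ℝ := ∑ j, ‖coeff u K j‖ ^ 2

theorem amp_nonneg (u : L2 L) (K : Fin 3 → ℤ) : 0 ≤ amp u K :=
  Finset.sum_nonneg fun _ _ => sq_nonneg _

theorem MemV.amp_zero {s : ℕ} {u : L2 L} (hu : MemV L s u) : amp u 0 = 0 :=
  Finset.sum_eq_zero fun j _ => by rw [hu.mean_zero j]; simp

theorem summable_amp (hL : 0 < L) (u : L2 L) : Summable (amp u) := (hasSum_normSq_coeff hL u).summable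

theorem norm_sq_eq (hL : 0 < L) (u : L2 L) : ‖u‖ ^ 2 = L ^ 3 * ∑' K, amp u K := by
  have : ∑' K, amp u K = ‖u‖ ^ 2 / L ^ 3 := (hasSum_normSq_coeff hL u).tsum_eq
  rw [this]
  field_simp

theorem MemV.of_le {s s' : ℕ} {u : L2 L} (hu : MemV L s u) (h : s' ≤ s) :
    MemV L s' u := by
  refine ⟨hu.mean_zero, hu.div_free, ?_⟩
  refine Summable.of_nonneg_of_le (fun K => mul_nonneg (pow_nonneg (freqSq_nonneg K) _)
    (amp_nonneg u K)) (fun K => ?_) hu.summable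
  by_cases hK : K = 0
  · have : amp u K = 0 := by rw [hK]; exact hu.amp_zero
    change _ * amp u K ≤ _ * amp u K
    rw [this, mul_zero, mul_zero]
  · exact mul_le_mul_of_nonneg_right (pow_le_pow_right₀ (one_le_freqSq hK) h) (amp_nonneg u K)

theorem MemV.summable_eigen {s s' : ℕ} {u : L2 L} (hu : MemV L s u) (h : s' ≤ s) :
    Summable fun K => eigen L K ^ s' * amp u K := by
  refine ((hu.of_le h).summable.mul_left (lam1 L ^ s')).congr fun K => ?_
  rw [eigen_eq, mul_pow, mul_assoc]
  rfl

theorem hNorm_sq (hL : 0 < L) (s : ℕ) (u : L2 L) :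
    hNorm s u ^ 2 = L ^ 3 * ∑' K, eigen L K ^ s * amp u K :=
  Real.sq_sqrt (mul_nonneg (by positivity) (tsum_nonneg fun K =>
    mul_nonneg (pow_nonneg (eigen_nonneg L K) s) (amp_nonneg u K)))

/-- The Poincaré inequality between consecutive orders. -/
theorem MemV.lam1_mul_hNorm_sq_le {s : ℕ} {u : L2 L} (hL : 0 < L) (hu : MemV L (s + 1) u) :
    lam1 L * hNorm s u ^ 2 ≤ hNorm (s + 1) u ^ 2 := by
  rw [hNorm_sq hL, hNorm_sq hL, mul_left_comm, ← tsum_mul_left]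
  refine mul_le_mul_of_nonneg_left ?_ (by positivity)
  refine ((hu.summable_eigen s.le_succ).mul_left _).tsum_le_tsum (fun K => ?_)
    (hu.summable_eigen le_rfl)
  by_cases hK : K = 0
  · have : amp u K = 0 := by rw [hK]; exact hu.amp_zero
    rw [this, mul_zero, mul_zero, mul_zero]
  · rw [pow_succ', mul_assoc]
    exact mul_le_mul_of_nonneg_right (lam1_le_eigen hL hK)
      (mul_nonneg (pow_nonneg (eigen_nonneg L K) s) (amp_nonneg u K))

theorem hNorm_zero (hL : 0 < L) (u : L2 L) : hNorm 0 u = ‖u‖ := by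
  have := hNorm_sq hL 0 u
  simp only [pow_zero, one_mul] at this
  rw [← norm_sq_eq hL] at this
  exact (pow_left_inj₀ (Real.sqrt_nonneg _) (norm_nonneg u) two_ne_zero).1 this

/-- The factor by which `∂_i` multiplies the Fourier coefficient at the frequency `K`. -/
def dmul (L : ℝ) (K : Fin 3 → ℤ) (i : Fin 3) : ℂ := 2 * Real.pi * Complex.I * (K i : ℂ) / L

theorem sum_norm_dmul_sq (L : ℝ) (K : Fin 3 → ℤ) : ∑ i, ‖dmul L K i‖ ^ 2 = eigen L K := by
  unfold dmul eigen freqSq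
  simp only [norm_div, norm_mul, Complex.norm_I, Complex.norm_real, Complex.norm_intCast,
    Complex.norm_ofNat, Real.norm_eq_abs, abs_of_pos Real.pi_pos, mul_one, div_pow, mul_pow, sq_abs]
  rw [Finset.mul_sum, Finset.sum_div]
  norm_num

/-- The Ladyzhenskaya inequality for trigonometric polynomials without constant term. -/
theorem integral_trig_pow_four_le (hL : 0 < L) (S : Finset (Fin 3 → ℤ)) (a : Coeffs)
    (ha : ∀ j, a 0 j = 0) :
    ∫ x in box L, (∑ j, ‖trig L S (fun K => a K j) x‖ ^ 2) ^ 2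
      ≤ 27 * Real.sqrt (L ^ 3 * ∑ K ∈ S, ∑ j, ‖a K j‖ ^ 2)
        * Real.sqrt (L ^ 3 * ∑ K ∈ S, eigen L K * ∑ j, ‖a K j‖ ^ 2) ^ 3 := by
  have hs0 : 0 ≤ L ^ 3 * ∑ K ∈ S, ∑ j, ‖a K j‖ ^ 2 := mul_nonneg (by positivity)
    (Finset.sum_nonneg fun _ _ => Finset.sum_nonneg fun _ _ => sq_nonneg _)
  have hs1 : 0 ≤ L ^ 3 * ∑ K ∈ S, eigen L K * ∑ j, ‖a K j‖ ^ 2 := mul_nonneg (by positivity)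
    (Finset.sum_nonneg fun _ _ => mul_nonneg (eigen_nonneg _ _)
      (Finset.sum_nonneg fun _ _ => sq_nonneg _))
  set p : Fin 3 → (Fin 3 → ℝ) → ℂ := fun j => trig L S (fun K => a K j) with hp
  set dp : Fin 3 → Fin 3 → (Fin 3 → ℝ) → ℂ := fun i j => trig L S (fun K => a K j * dmul L K i)
    with hdp
  have cp : ∀ j, Continuous (p j) := fun j => continuous_trig _ _
  have cdp : ∀ i j, Continuous (dp i j) := fun i j => continuous_trig _ _
  refine integral_sq_le_of_line_bound hL (N := fun x => ∑ j, ‖p j x‖ ^ 2)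
    (M := fun x => ∑ i, ∑ j, ‖dp i j x‖ ^ 2) (by fun_prop) (by fun_prop)
    (fun x => Finset.sum_nonneg fun _ _ => sq_nonneg _)
    (fun x => Finset.sum_nonneg fun _ _ => Finset.sum_nonneg fun _ _ => sq_nonneg _)
    (Real.sqrt_nonneg _) (Real.sqrt_nonneg _) ?_ ?_ ?_ ?_
  · rw [Real.sq_sqrt hs0, integral_finsetSum]
    · simp only [hp, integral_norm_sq_trig hL, ← Finset.mul_sum]
      rw [Finset.sum_comm]
    · exact fun j _ => Continuous.integrable_box (φ := fun x => ‖p j x‖ ^ 2) (by fun_prop)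
  · rw [Real.sq_sqrt hs1, integral_finsetSum]
    · rw [Finset.sum_congr rfl fun i _ => integral_finsetSum Finset.univ fun j _ =>
        Continuous.integrable_box (φ := fun x => ‖dp i j x‖ ^ 2) (by fun_prop)]
      simp only [hdp, integral_norm_sq_trig hL, ← Finset.mul_sum, norm_mul, mul_pow]
      congr 1
      rw [Finset.sum_congr rfl fun i _ => Finset.sum_comm, Finset.sum_comm]
      refine Finset.sum_congr rfl fun K _ => ?_
      rw [← sum_norm_dmul_sq, Finset.sum_mul_sum]
      exact Finset.sum_congr rfl fun i _ => Finset.sum_congr rfl fun j _ => mul_comm _ _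
    · exact fun i _ => Continuous.integrable_box (φ := fun x => ∑ j, ‖dp i j x‖ ^ 2) (by fun_prop)
  · -- the Poincaré inequality, with `2π` replaced by `6`
    have h6 : 6 / L = Real.sqrt (36 / L ^ 2) := by
      rw [show (36 : ℝ) / L ^ 2 = (6 / L) ^ 2 by ring, Real.sqrt_sq (by positivity)]
    have : 6 / L * Real.sqrt (L ^ 3 * ∑ K ∈ S, ∑ j, ‖a K j‖ ^ 2)
        ≤ Real.sqrt (L ^ 3 * ∑ K ∈ S, eigen L K * ∑ j, ‖a K j‖ ^ 2) := by
      rw [h6, ← Real.sqrt_mul (by positivity), mul_left_comm, Finset.mul_sum]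
      refine Real.sqrt_le_sqrt (mul_le_mul_of_nonneg_left (Finset.sum_le_sum fun K _ => ?_)
        (by positivity))
      by_cases hK : K = 0
      · simp [hK, ha]
      · refine mul_le_mul_of_nonneg_right (le_trans ?_ (lam1_le_eigen hL hK))
          (Finset.sum_nonneg fun _ _ => sq_nonneg _)
        unfold lam1
        gcongr
        nlinarith [Real.pi_gt_three]
    have h7 := mul_le_mul_of_nonneg_left this (show 0 ≤ L / 6 by positivity)
    rw [← mul_assoc, show L / 6 * (6 / L) = 1 by field_simp, one_mul] at h7
    linarith
  · intro x hx i
    set y : ℝ → Fin 3 → ℝ := fun s => Function.update x i s with hy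
    have cy : Continuous y := by fun_prop
    set N : ℝ → ℝ := fun s => ∑ j, ‖p j (y s)‖ ^ 2 with hN
    set M : ℝ → ℝ := fun s => ∑ i, ∑ j, ‖dp i j (y s)‖ ^ 2 with hM
    set N' : ℝ → ℝ := fun s => ∑ j, 2 * inner ℝ (p j (y s)) (dp i j (y s)) with hN'
    have dN : ∀ s, HasDerivAt N (N' s) s := fun s => by
      refine HasDerivAt.fun_sum fun j _ => ?_
      have h := hasDerivAt_trig_update (L := L) S (fun K => a K j) x i s
      have h2 := HasDerivAt.norm_sq h
      exact h2
    have cN : Continuous N := by fun_prop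
    have cM : Continuous M := by fun_prop
    have cN' : Continuous N' := by fun_prop
    have hN0 : ∀ s, 0 ≤ N s := fun s => Finset.sum_nonneg fun _ _ => sq_nonneg _
    have hNM : ∀ s, |N' s| ≤ 2 * (Real.sqrt (N s) * Real.sqrt (M s)) := fun s => by
      have h1 : |N' s| ≤ 2 * ∑ j, ‖p j (y s)‖ * ‖dp i j (y s)‖ := by
        refine (Finset.abs_sum_le_sum_abs _ _).trans ?_
        rw [Finset.mul_sum]
        refine Finset.sum_le_sum fun j _ => ?_
        rw [abs_mul, abs_two]
        exact mul_le_mul_of_nonneg_left (abs_real_inner_le_norm _ _) zero_le_two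
      refine h1.trans (mul_le_mul_of_nonneg_left ?_ zero_le_two)
      refine (Real.sum_mul_le_sqrt_mul_sqrt _ _ _).trans
        (mul_le_mul_of_nonneg_left (Real.sqrt_le_sqrt ?_) (Real.sqrt_nonneg _))
      exact Finset.single_le_sum (f := fun i => ∑ j, ‖dp i j (y s)‖ ^ 2)
        (fun _ _ => Finset.sum_nonneg fun _ _ => sq_nonneg _) (Finset.mem_univ i)
    have hper : N L ^ 2 = N 0 ^ 2 := by
      simp only [hN, hy, hp, trig_update_period hL]
    have key := le_mean_add_half_variation hL (h := fun s => N s ^ 2)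
      (h' := fun s => 2 * N s * N' s) (fun s => by
        refine ((dN s).fun_pow 2).congr_deriv ?_
        norm_num) (by fun_prop) hper
      (x := x i) ⟨hx.1 i, hx.2 i⟩
    have hxi : y (x i) = x := Function.update_eq_self i x
    have e : N (x i) = ∑ j, ‖p j x‖ ^ 2 := by simp only [hN, hxi]
    simp only [e] at key
    refine key.trans ?_
    rw [intervalIntegral.integral_add, intervalIntegral.integral_div]
    · refine add_le_add le_rfl ?_
      rw [← intervalIntegral.integral_div]
      refine intervalIntegral.integral_mono_on hL.le (Continuous.intervalIntegrable (by fun_prop) _ _)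
        (Continuous.intervalIntegrable (by fun_prop) _ _) fun s _ => ?_
      change |2 * N s * N' s| / 2 ≤ 2 * (N s * Real.sqrt (N s) * Real.sqrt (M s))
      rw [abs_mul, abs_mul, abs_two, abs_of_nonneg (hN0 s)]
      have := mul_le_mul_of_nonneg_left (hNM s) (hN0 s)
      linarith
    · exact Continuous.intervalIntegrable (by fun_prop) _ _
    · exact Continuous.intervalIntegrable (by fun_prop) _ _

/-! ### The Ladyzhenskaya inequality with an explicit constant -/

/-- The Fourier coefficients of the products `P_i P_j` of the components of a Fourier partial sum
converge to those of `g_i g_j`. -/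
theorem tendsto_fourierC_trig_mul (hL : 0 < L) (g : L2 L) (i j : Fin 3) (K : Fin 3 → ℤ) :
    Tendsto (fun S : Finset (Fin 3 → ℤ) => fourierC L (fun x =>
        trig L S (fun J => coeff g J i) x * trig L S (fun J => coeff g J j) x) K) atTop
      (𝓝 (tensor g g i j K)) := by
  classical
  have e : ∀ S : Finset (Fin 3 → ℤ), fourierC L (fun x =>
        trig L S (fun J => coeff g J i) x * trig L S (fun J => coeff g J j) x) K
      = ∑' J, (if K - J ∈ S then coeff g (K - J) i else 0) * (if J ∈ S then coeff g J j else 0) :=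
    fun S => by
      have h := hasSum_fourierC_mul hL ((continuous_trig (L := L) S (fun J => coeff g J i)).memLp_box 2)
        ((continuous_trig (L := L) S (fun J => coeff g J j)).memLp_box 2) K
      simp only [fourierC_trig hL] at h
      exact h.tsum_eq.symm
  simp only [e]
  rw [← (hasSum_tensor hL g g i j K).tsum_eq]
  refine tendsto_tsum_of_dominated_convergence
    (bound := fun J => ‖coeff g (K - J) i * coeff g J j‖) (hasSum_tensor hL g g i j K).summable.norm
    (fun J => ?_) (Eventually.of_forall fun S J => ?_)
  · refine tendsto_const_nhds.congr' ?_
    filter_upwards [eventually_ge_atTop {K - J, J}] with S hS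
    rw [if_pos (hS (by simp)), if_pos (hS (by simp))]
  · split_ifs
    · exact le_rfl
    all_goals (simp; positivity)

/-- The Ladyzhenskaya inequality `‖g‖_{L⁴}⁴ ≤ 27 ‖g‖ ‖∇g‖³` on `V`. -/
theorem quarticBound_twentySeven (hL : 0 < L) : QuarticBound L 27 := by
  intro g hg
  have key : ∀ F : Finset (Fin 3 → ℤ),
      ∑ K ∈ F, tensorSq g K ≤ 1 / L ^ 3 * (27 * ‖g‖ * hNorm 1 g ^ 3) := by
    intro F
    have hlim : Tendsto (fun S : Finset (Fin 3 → ℤ) => ∑ K ∈ F, ∑ i, ∑ j, ‖fourierC L (fun x =>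
        trig L S (fun J => coeff g J i) x * trig L S (fun J => coeff g J j) x) K‖ ^ 2) atTop
        (𝓝 (∑ K ∈ F, tensorSq g K)) :=
      tendsto_finsetSum _ fun K _ => tendsto_finsetSum _ fun i _ => tendsto_finsetSum _ fun j _ =>
        ((tendsto_fourierC_trig_mul hL g i j K).norm).pow 2
    refine le_of_tendsto' hlim fun S => ?_
    set p : Fin 3 → (Fin 3 → ℝ) → ℂ := fun j => trig L S (fun K => coeff g K j) with hp
    have cp : ∀ j, Continuous (p j) := fun j => continuous_trig _ _
    have hs : HasSum (fun K => ∑ i, ∑ j, ‖fourierC L (fun x => p i x * p j x) K‖ ^ 2)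
        (∑ i, ∑ j, 1 / L ^ 3 * ∫ x in box L, ‖p i x * p j x‖ ^ 2) :=
      hasSum_sum fun i _ => hasSum_sum fun j _ =>
        hasSum_normSq_fourierC hL (Continuous.memLp_box (by fun_prop) 2)
    have h1 := sum_le_hasSum F (fun K _ => Finset.sum_nonneg fun i _ =>
      Finset.sum_nonneg fun j _ => sq_nonneg _) hs
    refine h1.trans ?_
    have e : ∑ i, ∑ j, 1 / L ^ 3 * ∫ x in box L, ‖p i x * p j x‖ ^ 2
        = 1 / L ^ 3 * ∫ x in box L, (∑ j, ‖p j x‖ ^ 2) ^ 2 := by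
      have hi : ∀ i j, Integrable (fun x => ‖p i x * p j x‖ ^ 2) (volume.restrict (box L)) :=
        fun i j => Continuous.integrable_box (by fun_prop)
      simp only [← Finset.mul_sum]
      rw [Finset.sum_congr rfl fun i _ => (integral_finsetSum Finset.univ fun j _ => hi i j).symm,
        ← integral_finsetSum Finset.univ fun i _ => integrable_finsetSum _ fun j _ => hi i j]
      simp only [sq (∑ j, ‖p j _‖ ^ 2), Finset.sum_mul_sum, norm_mul, mul_pow]
    rw [e]
    refine mul_le_mul_of_nonneg_left ?_ (by positivity)
    refine (integral_trig_pow_four_le hL S (coeff g) hg.mean_zero).trans ?_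
    have n0 : Real.sqrt (L ^ 3 * ∑ K ∈ S, ∑ j, ‖coeff g K j‖ ^ 2) ≤ ‖g‖ := by
      rw [← Real.sqrt_sq (norm_nonneg g), norm_sq_eq hL]
      exact Real.sqrt_le_sqrt (mul_le_mul_of_nonneg_left
        ((summable_amp hL g).sum_le_tsum S fun K _ => amp_nonneg g K) (by positivity))
    have n1 : Real.sqrt (L ^ 3 * ∑ K ∈ S, eigen L K * ∑ j, ‖coeff g K j‖ ^ 2) ≤ hNorm 1 g := by
      rw [← Real.sqrt_sq (hNorm_nonneg 1 g), hNorm_sq hL]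
      simp only [pow_one]
      have := hg.summable_eigen le_rfl
      simp only [pow_one] at this
      exact Real.sqrt_le_sqrt (mul_le_mul_of_nonneg_left
        (this.sum_le_tsum S fun K _ => mul_nonneg (eigen_nonneg L K) (amp_nonneg g K))
        (by positivity))
    gcongr
  have hsum : Summable (tensorSq g) := summable_of_sum_le (tensorSq_nonneg g) key
  refine ⟨hsum, ?_⟩
  have h2 := hsum.tsum_le_of_sum_le key
  calc L ^ 3 * ∑' K, tensorSq g K ≤ L ^ 3 * (1 / L ^ 3 * (27 * ‖g‖ * hNorm 1 g ^ 3)) :=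
        mul_le_mul_of_nonneg_left h2 (by positivity)
    _ = _ := by field_simp

/-! ### Absolute convergence of series -/

/-- Convergence of `∑ |K|⁻⁴` over the lattice `ℤ³`; the exponent exceeds the rank. The frequency
`K = 0` contributes `0⁻¹ = 0`. -/
theorem summable_inv_freqSq_sq : Summable fun K : Fin 3 → ℤ => (freqSq K ^ 2)⁻¹ := by
  set b := Pi.basisFun ℝ (Fin 3) with hb
  set Λ := Submodule.span ℤ (Set.range b) with hΛ
  have h4 := ZLattice.summable_norm_pow_inv (L := Λ) 4 (by
    rw [ZLattice.rank ℝ Λ]; simp)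
  have hmem : ∀ K : Fin 3 → ℤ, (fun i => (K i : ℝ)) ∈ Λ := fun K => by
    have : (fun i => (K i : ℝ)) = ∑ i, K i • b i := by
      ext j
      simp [hb, Finset.sum_apply, Pi.single_apply]
    rw [this]
    exact Submodule.sum_mem _ fun i _ => Submodule.smul_mem _ _ (Submodule.subset_span ⟨i, rfl⟩)
  let e : (Fin 3 → ℤ) → Λ := fun K => ⟨fun i => (K i : ℝ), hmem K⟩
  have he : Function.Injective e := fun K J h => by
    funext i
    have : (K i : ℝ) = J i := congrFun (congrArg Subtype.val h) i
    exact_mod_cast this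
  have e0 : e 0 = 0 := Subtype.ext (by ext i; simp [e])
  refine Summable.of_nonneg_of_le (fun K => by positivity) (fun K => ?_) (h4.comp_injective he)
  by_cases hK : K = 0
  · simp [hK, freqSq]
  · have h1 : ‖e K‖ ^ 2 ≤ freqSq K := by
      have : ‖e K‖ ≤ Real.sqrt (freqSq K) := by
        refine (pi_norm_le_iff_of_nonneg (Real.sqrt_nonneg _)).2 fun i => ?_
        rw [Real.norm_eq_abs]
        refine Real.abs_le_sqrt ?_
        exact Finset.single_le_sum (f := fun i => (K i : ℝ) ^ 2) (fun _ _ => sq_nonneg _)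
          (Finset.mem_univ i)
      calc ‖e K‖ ^ 2 ≤ Real.sqrt (freqSq K) ^ 2 := pow_le_pow_left₀ (norm_nonneg _) this 2
        _ = _ := Real.sq_sqrt (freqSq_nonneg K)
    have h2 : 0 < ‖e K‖ := norm_pos_iff.2 fun h => hK (he (h.trans e0.symm))
    simp only [Function.comp, inv_pow]
    refine inv_anti₀ (by positivity) ?_
    calc ‖e K‖ ^ 4 = (‖e K‖ ^ 2) ^ 2 := by ring
      _ ≤ _ := pow_le_pow_left₀ (by positivity) h1 2

/-- The Fourier series of a field of `D(A)` converges absolutely. -/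
theorem MemV.summable_norm_coeff {u : L2 L} (hu : MemV L 2 u) (j : Fin 3) :
    Summable fun K => ‖coeff u K j‖ := by
  refine Summable.of_nonneg_of_le (fun K => norm_nonneg _) (fun K => ?_)
    (summable_inv_freqSq_sq.add hu.summable)
  by_cases hK : K = 0
  · rw [hK, hu.mean_zero j, norm_zero]
    exact add_nonneg (by positivity) (mul_nonneg (by positivity) (amp_nonneg u 0))
  · have h1 : ‖coeff u K j‖ ^ 2 ≤ amp u K :=
      Finset.single_le_sum (f := fun j => ‖coeff u K j‖ ^ 2) (fun i _ => sq_nonneg _)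
        (Finset.mem_univ j)
    have h0 := one_le_freqSq hK
    have h2 : freqSq K ^ 2 * ‖coeff u K j‖ ^ 2 ≤ freqSq K ^ 2 * amp u K := by gcongr
    change ‖coeff u K j‖ ≤ (freqSq K ^ 2)⁻¹ + freqSq K ^ 2 * amp u K
    have h3 : ‖coeff u K j‖ ≤ (freqSq K ^ 2)⁻¹ + freqSq K ^ 2 * ‖coeff u K j‖ ^ 2 := by
      set q := freqSq K with hq
      set a := ‖coeff u K j‖ with ha
      have ha0 : 0 ≤ a := norm_nonneg _
      have e : (q ^ 2)⁻¹ + q ^ 2 * a ^ 2 = (q⁻¹ - q * a) ^ 2 + 2 * a := by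
        have : q ≠ 0 := by positivity
        field_simp
        ring
      nlinarith [sq_nonneg (q⁻¹ - q * a)]
    linarith

/-- The Cauchy-Schwarz inequality for series of real numbers. -/
theorem summable_mul_and_abs_tsum_le {ι : Type*} {x y : ι → ℝ} (hx : Summable fun k => x k ^ 2)
    (hy : Summable fun k => y k ^ 2) :
    Summable (fun k => x k * y k) ∧
      |∑' k, x k * y k| ≤ Real.sqrt (∑' k, x k ^ 2) * Real.sqrt (∑' k, y k ^ 2) := by
  have hs : Summable fun k => |x k * y k| := by
    refine Summable.of_nonneg_of_le (fun k => abs_nonneg _) (fun k => ?_) (hx.add hy)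
    rw [abs_mul]
    nlinarith [sq_nonneg (|x k| - |y k|), sq_abs (x k), sq_abs (y k), abs_nonneg (x k),
      abs_nonneg (y k)]
  refine ⟨hs.of_abs, ?_⟩
  have h1 : |∑' k, x k * y k| ≤ ∑' k, |x k * y k| := by
    exact norm_tsum_le_tsum_norm (f := fun k => x k * y k) hs
  refine h1.trans (hs.tsum_le_of_sum_le fun s => ?_)
  have h2 := Real.sum_mul_le_sqrt_mul_sqrt s (fun k => |x k|) (fun k => |y k|)
  simp only [sq_abs] at h2
  simp only [abs_mul]
  refine h2.trans (mul_le_mul (Real.sqrt_le_sqrt (hx.sum_le_tsum s fun k _ => sq_nonneg _))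
    (Real.sqrt_le_sqrt (hy.sum_le_tsum s fun k _ => sq_nonneg _)) (Real.sqrt_nonneg _)
    (Real.sqrt_nonneg _))

/-- Absolute convergence of the double series of a convolution of `a ∈ ℓ¹` and `b ∈ ℓ²` paired
with `c ∈ ℓ²`. -/
theorem summable_convolution_mul {a b c : (Fin 3 → ℤ) → ℂ} (ha : Summable fun K => ‖a K‖)
    (hb : Summable fun K => ‖b K‖ ^ 2) (hc : Summable fun K => ‖c K‖ ^ 2) :
    Summable fun p : (Fin 3 → ℤ) × (Fin 3 → ℤ) => a (p.1 - p.2) * b p.2 * c p.1 := by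
  let e1 : (Fin 3 → ℤ) × (Fin 3 → ℤ) ≃ (Fin 3 → ℤ) × (Fin 3 → ℤ) :=
    { toFun := fun p => (p.1 - p.2, p.2)
      invFun := fun p => (p.1 + p.2, p.2)
      left_inv := fun p => by simp
      right_inv := fun p => by simp }
  let e2 : (Fin 3 → ℤ) × (Fin 3 → ℤ) ≃ (Fin 3 → ℤ) × (Fin 3 → ℤ) :=
    { toFun := fun p => (p.1 - p.2, p.1)
      invFun := fun p => (p.2, p.2 - p.1)
      left_inv := fun p => by simp
      right_inv := fun p => by simp }
  have h1 : Summable fun p : (Fin 3 → ℤ) × (Fin 3 → ℤ) => ‖a (p.1 - p.2)‖ * ‖b p.2‖ ^ 2 :=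
    e1.summable_iff.2 (ha.mul_of_nonneg hb (fun _ => norm_nonneg _) (fun _ => sq_nonneg _))
  have h2 : Summable fun p : (Fin 3 → ℤ) × (Fin 3 → ℤ) => ‖a (p.1 - p.2)‖ * ‖c p.1‖ ^ 2 :=
    e2.summable_iff.2 (ha.mul_of_nonneg hc (fun _ => norm_nonneg _) (fun _ => sq_nonneg _))
  refine Summable.of_norm_bounded (h1.add h2) fun p => ?_
  rw [norm_mul, norm_mul, ← mul_add, mul_assoc]
  refine mul_le_mul_of_nonneg_left ?_ (norm_nonneg _)
  nlinarith [sq_nonneg (‖b p.2‖ - ‖c p.1‖), norm_nonneg (b p.2), norm_nonneg (c p.1)]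

/-! ### The advection term and the trilinear form -/

theorem norm_dmul_sq_le (L : ℝ) (K : Fin 3 → ℤ) (i : Fin 3) : ‖dmul L K i‖ ^ 2 ≤ eigen L K := by
  rw [← sum_norm_dmul_sq]
  exact Finset.single_le_sum (f := fun i => ‖dmul L K i‖ ^ 2) (fun _ _ => sq_nonneg _)
    (Finset.mem_univ i)

theorem norm_coeff_sq_le_amp (u : L2 L) (K : Fin 3 → ℤ) (j : Fin 3) :
    ‖coeff u K j‖ ^ 2 ≤ amp u K :=
  Finset.single_le_sum (f := fun j => ‖coeff u K j‖ ^ 2) (fun _ _ => sq_nonneg _)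
    (Finset.mem_univ j)

theorem summable_norm_coeff_sq (hL : 0 < L) (u : L2 L) (j : Fin 3) :
    Summable fun K => ‖coeff u K j‖ ^ 2 :=
  Summable.of_nonneg_of_le (fun _ => sq_nonneg _) (fun K => norm_coeff_sq_le_amp u K j)
    (summable_amp hL u)

theorem MemV.summable_norm_dmul_coeff_sq {v : L2 L} (hv : MemV L 1 v) (i j : Fin 3) :
    Summable fun K => ‖dmul L K i * coeff v K j‖ ^ 2 := by
  refine Summable.of_nonneg_of_le (fun _ => sq_nonneg _) (fun K => ?_)
    (hv.summable_eigen le_rfl)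
  rw [norm_mul, mul_pow, pow_one]
  exact mul_le_mul (norm_dmul_sq_le L K i) (norm_coeff_sq_le_amp v K j) (sq_nonneg _)
    (eigen_nonneg L K)

theorem MemV.sum_coeff_mul_dmul {s : ℕ} {u : L2 L} (hu : MemV L s u) (K J : Fin 3 → ℤ) :
    ∑ i, coeff u (K - J) i * dmul L J i = ∑ i, coeff u (K - J) i * dmul L K i := by
  rw [← sub_eq_zero, ← Finset.sum_sub_distrib]
  have h := hu.div_free (K - J)
  calc _ = -(2 * Real.pi * Complex.I / L) * ∑ j, ((K - J) j : ℂ) * coeff u (K - J) j := by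
        rw [Finset.mul_sum]
        refine Finset.sum_congr rfl fun i _ => ?_
        simp only [dmul, Pi.sub_apply, Int.cast_sub]
        ring
    _ = 0 := by rw [h, mul_zero]

/-- `(u · ∇) v = div (u ⊗ v)` for divergence-free `u`. -/
theorem MemV.hasSum_advect {s : ℕ} (hL : 0 < L) {u : L2 L} (hu : MemV L s u) (v : L2 L)
    (K : Fin 3 → ℤ) (j : Fin 3) :
    HasSum (fun J => (∑ i, coeff u (K - J) i * dmul L J i) * coeff v J j)
      (∑ i, dmul L K i * tensor u v i j K) := by
  have h : HasSum _ _ := hasSum_sum (s := Finset.univ) fun i _ =>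
    (hasSum_tensor hL u v i j K).mul_left (dmul L K i)
  refine h.congr_fun fun J => ?_
  rw [hu.sum_coeff_mul_dmul, Finset.sum_mul]
  exact Finset.sum_congr rfl fun i _ => by ring

theorem MemV.advect_eq {s : ℕ} (hL : 0 < L) {u : L2 L} (hu : MemV L s u) (v : L2 L)
    (K : Fin 3 → ℤ) (j : Fin 3) :
    advect u v K j = ∑ i, dmul L K i * tensor u v i j K :=
  (hu.hasSum_advect hL v K j).tsum_eq

theorem tensor_sub_left (hL : 0 < L) (u u' v : L2 L) (i j : Fin 3) (K : Fin 3 → ℤ) :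
    tensor (u - u') v i j K = tensor u v i j K - tensor u' v i j K := by
  refine (hasSum_tensor hL (u - u') v i j K).unique ?_
  refine ((hasSum_tensor hL u v i j K).sub (hasSum_tensor hL u' v i j K)).congr_fun fun J => ?_
  rw [coeff_sub, sub_mul]

theorem tensor_sub_right (hL : 0 < L) (u v v' : L2 L) (i j : Fin 3) (K : Fin 3 → ℤ) :
    tensor u (v - v') i j K = tensor u v i j K - tensor u v' i j K := by
  refine (hasSum_tensor hL u (v - v') i j K).unique ?_
  refine ((hasSum_tensor hL u v i j K).sub (hasSum_tensor hL u v' i j K)).congr_fun fun J => ?_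
  rw [coeff_sub, mul_sub]

/-- `(w · ∇) w - (u · ∇) u = (w · ∇) (w - u) + ((w - u) · ∇) u`. -/
theorem advect_self_sub_advect_self {s : ℕ} (hL : 0 < L) {u w : L2 L} (hu : MemV L s u)
    (hw : MemV L s w) (hg : MemV L s (w - u)) (K : Fin 3 → ℤ) (j : Fin 3) :
    advect w w K j - advect u u K j = advect w (w - u) K j + advect (w - u) u K j := by
  rw [hw.advect_eq hL, hu.advect_eq hL, hw.advect_eq hL, hg.advect_eq hL,
    ← Finset.sum_sub_distrib, ← Finset.sum_add_distrib]
  refine Finset.sum_congr rfl fun i _ => ?_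
  rw [tensor_sub_right hL, tensor_sub_left hL]
  ring

/-- The coefficients of `(u · ∇) u = div (u ⊗ u)` cost one derivative of `u ⊗ u`. -/
theorem norm_advect_sq_le {s : ℕ} (hL : 0 < L) {u : L2 L} (hu : MemV L s u) (K : Fin 3 → ℤ) :
    ∑ j, ‖advect u u K j‖ ^ 2 ≤ eigen L K * tensorSq u K := by
  have h : ∀ j, ‖advect u u K j‖ ^ 2 ≤ eigen L K * ∑ i, ‖tensor u u i j K‖ ^ 2 := fun j => by
    rw [hu.advect_eq hL, ← sum_norm_dmul_sq]
    calc ‖∑ i, dmul L K i * tensor u u i j K‖ ^ 2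
        ≤ (∑ i, ‖dmul L K i‖ * ‖tensor u u i j K‖) ^ 2 := by
          refine pow_le_pow_left₀ (norm_nonneg _) ((norm_sum_le _ _).trans_eq ?_) 2
          simp only [norm_mul]
      _ ≤ _ := Finset.sum_mul_sq_le_sq_mul_sq _ _ _
  refine (Finset.sum_le_sum fun j _ => h j).trans_eq ?_
  rw [← Finset.mul_sum, tensorSq, Finset.sum_comm]

/-- The terms of the double series for the trilinear form `∫ (u · ∇) v · w`. -/
def triTerm (u v w : L2 L) (p : (Fin 3 → ℤ) × (Fin 3 → ℤ)) : ℂ :=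
  ∑ j, (∑ i, coeff u (p.1 - p.2) i * dmul L p.2 i) * coeff v p.2 j *
    (starRingEnd ℂ) (coeff w p.1 j)

theorem summable_triTerm (hL : 0 < L) {u v : L2 L} (hu : MemV L 2 u) (hv : MemV L 1 v) (w : L2 L) :
    Summable (triTerm u v w) := by
  have h : ∀ j i, Summable fun p : (Fin 3 → ℤ) × (Fin 3 → ℤ) => coeff u (p.1 - p.2) i *
      (dmul L p.2 i * coeff v p.2 j) * (starRingEnd ℂ) (coeff w p.1 j) := fun j i =>
    summable_convolution_mul (a := fun K => coeff u K i) (b := fun K => dmul L K i * coeff v K j)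
      (c := fun K => (starRingEnd ℂ) (coeff w K j)) (hu.summable_norm_coeff i)
      (hv.summable_norm_dmul_coeff_sq i j)
      (by simpa only [RCLike.norm_conj] using summable_norm_coeff_sq hL w j)
  have h2 := summable_sum (s := Finset.univ) fun j _ => summable_sum (s := Finset.univ)
    fun i _ => h j i
  refine h2.congr fun p => ?_
  unfold triTerm
  refine Finset.sum_congr rfl fun j _ => ?_
  rw [Finset.sum_mul, Finset.sum_mul]
  exact Finset.sum_congr rfl fun i _ => by ring

/-- The trilinear form, summed over the frequency of `(u · ∇) v`. -/
theorem hasSum_advect_mul (hL : 0 < L) {u v : L2 L} (hu : MemV L 2 u) (hv : MemV L 1 v)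
    (w : L2 L) :
    HasSum (fun K => ∑ j, advect u v K j * (starRingEnd ℂ) (coeff w K j))
      (∑' p, triTerm u v w p) := by
  refine HasSum.prod_fiberwise (f := triTerm u v w) (summable_triTerm hL hu hv w).hasSum
    fun K => ?_
  simp only [triTerm]
  refine hasSum_sum fun j _ => ?_
  rw [hu.advect_eq hL]
  exact (hu.hasSum_advect hL v K j).mul_right _

/-- The trilinear form vanishes when its last two arguments coincide. -/
theorem re_tsum_triTerm_self {u : L2 L} (hu : MemV L 2 u) (v : L2 L) :
    (∑' p, triTerm u v v p).re = 0 := by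
  have h : ∀ p : (Fin 3 → ℤ) × (Fin 3 → ℤ),
      (starRingEnd ℂ) (triTerm u v v p) = -triTerm u v v p.swap := by
    rintro ⟨K, J⟩
    have e : (starRingEnd ℂ) (∑ i, coeff u (K - J) i * dmul L J i)
        = -∑ i, coeff u (J - K) i * dmul L K i := by
      rw [hu.sum_coeff_mul_dmul J K, map_sum, ← Finset.sum_neg_distrib]
      refine Finset.sum_congr rfl fun i _ => ?_
      rw [map_mul, ← coeff_neg_freq, neg_sub]
      simp [dmul, Complex.conj_ofNat, neg_div]
    simp only [triTerm, map_sum, map_mul, Prod.swap_prod_mk, Complex.conj_conj,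
      ← Finset.sum_neg_distrib]
    refine Finset.sum_congr rfl fun j _ => ?_
    have e' := e
    simp only [map_sum, map_mul] at e'
    rw [e']
    ring
  have h2 : (starRingEnd ℂ) (∑' p, triTerm u v v p) = -∑' p, triTerm u v v p := by
    rw [Complex.conj_tsum]
    simp only [h]
    rw [tsum_neg]
    have h3 := (Equiv.prodComm (Fin 3 → ℤ) (Fin 3 → ℤ)).tsum_eq (triTerm u v v)
    simp only [Equiv.prodComm_apply] at h3
    rw [h3]
  have h3 := congrArg Complex.re h2
  rw [Complex.conj_re, Complex.neg_re] at h3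
  linarith

/-- `|∫ (g · ∇) u · g| ≤ ‖∇u‖ ‖g ⊗ g‖`. -/
theorem norm_tsum_triTerm_le (hL : 0 < L) {g u : L2 L} (hg : MemV L 2 g) (hu : MemV L 1 u)
    (hT : Summable (tensorSq g)) :
    L ^ 3 * ‖∑' p, triTerm g u g p‖ ≤ hNorm 1 u * Real.sqrt (L ^ 3 * ∑' K, tensorSq g K) := by
  have hF := summable_triTerm hL hg hu g
  have hsw : HasSum (fun p : (Fin 3 → ℤ) × (Fin 3 → ℤ) => triTerm g u g p.swap)
      (∑' p, triTerm g u g p) :=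
    (Equiv.prodComm (Fin 3 → ℤ) (Fin 3 → ℤ)).hasSum_iff (f := triTerm g u g) |>.2 hF.hasSum
  have h : HasSum (fun J => ∑ j, ∑ i, dmul L J i * coeff u J j *
      (starRingEnd ℂ) (tensor g g i j J)) (∑' p, triTerm g u g p) := by
    refine HasSum.prod_fiberwise (f := fun p : (Fin 3 → ℤ) × (Fin 3 → ℤ) => triTerm g u g p.swap)
      hsw fun J => ?_
    have h1 : HasSum _ _ := hasSum_sum (s := Finset.univ) fun j _ => hasSum_sum (s := Finset.univ)
      fun i _ => ((Complex.hasSum_conj'.2 (hasSum_tensor hL g g i j J))).mul_left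
        (dmul L J i * coeff u J j)
    refine h1.congr_fun fun K => ?_
    simp only [triTerm, Prod.swap_prod_mk]
    refine Finset.sum_congr rfl fun j _ => ?_
    rw [Finset.sum_mul, Finset.sum_mul]
    refine Finset.sum_congr rfl fun i _ => ?_
    rw [map_mul, ← coeff_neg_freq g (J - K) i, neg_sub]
    ring
  have hb : ∀ J, ‖∑ j, ∑ i, dmul L J i * coeff u J j * (starRingEnd ℂ) (tensor g g i j J)‖
      ≤ Real.sqrt (eigen L J * amp u J) * Real.sqrt (tensorSq g J) := fun J => by
    calc _ ≤ ∑ j, ∑ i, ‖dmul L J i * coeff u J j‖ * ‖tensor g g i j J‖ := by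
          refine (norm_sum_le _ _).trans (Finset.sum_le_sum fun j _ =>
            (norm_sum_le _ _).trans_eq ?_)
          simp only [norm_mul, RCLike.norm_conj]
      _ = ∑ q : Fin 3 × Fin 3, ‖dmul L J q.2 * coeff u J q.1‖ * ‖tensor g g q.2 q.1 J‖ := by
          rw [Fintype.sum_prod_type]
      _ ≤ _ := Real.sum_mul_le_sqrt_mul_sqrt _ _ _
      _ = _ := by
          rw [Fintype.sum_prod_type, Fintype.sum_prod_type, tensorSq, amp, ← sum_norm_dmul_sq,
            Finset.sum_comm, Finset.sum_mul_sum, Finset.sum_comm (f := fun x y =>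
              ‖tensor g g y x J‖ ^ 2)]
          simp only [norm_mul, mul_pow]
  have hu1 : Summable fun J => Real.sqrt (eigen L J * amp u J) ^ 2 := by
    have := hu.summable_eigen le_rfl
    refine this.congr fun J => ?_
    rw [Real.sq_sqrt (mul_nonneg (eigen_nonneg L J) (amp_nonneg u J)), pow_one]
  have hT1 : Summable fun J => Real.sqrt (tensorSq g J) ^ 2 :=
    hT.congr fun J => (Real.sq_sqrt (tensorSq_nonneg g J)).symm
  obtain ⟨cs, cs'⟩ := summable_mul_and_abs_tsum_le hu1 hT1
  have h4 : ‖∑' p, triTerm g u g p‖ ≤ Real.sqrt (∑' J, Real.sqrt (eigen L J * amp u J) ^ 2)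
      * Real.sqrt (∑' J, Real.sqrt (tensorSq g J) ^ 2) := by
    rw [← h.tsum_eq]
    exact (tsum_of_norm_bounded cs.hasSum hb).trans ((le_abs_self _).trans cs')
  have e1 : ∑' J, Real.sqrt (eigen L J * amp u J) ^ 2 = ∑' J, eigen L J ^ 1 * amp u J :=
    tsum_congr fun J => by
      rw [Real.sq_sqrt (mul_nonneg (eigen_nonneg L J) (amp_nonneg u J)), pow_one]
  have e2 : ∑' J, Real.sqrt (tensorSq g J) ^ 2 = ∑' J, tensorSq g J :=
    tsum_congr fun J => Real.sq_sqrt (tensorSq_nonneg g J)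
  rw [e1, e2] at h4
  have e3 : hNorm 1 u = Real.sqrt (L ^ 3) * Real.sqrt (∑' J, eigen L J ^ 1 * amp u J) := by
    rw [← Real.sqrt_mul (by positivity)]
    rfl
  rw [e3, Real.sqrt_mul (by positivity)]
  calc L ^ 3 * ‖∑' p, triTerm g u g p‖ ≤ L ^ 3 * _ := mul_le_mul_of_nonneg_left h4 (by positivity)
    _ = (Real.sqrt (L ^ 3) * Real.sqrt (L ^ 3)) * _ := by
        rw [Real.mul_self_sqrt (by positivity)]
    _ = _ := by ring

/-! ### Energy balances at a fixed time -/

/-- The real part of the Hermitian product `a_K · conj b_K`. -/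
def pair (a b : Coeffs) (K : Fin 3 → ℤ) : ℝ := ∑ j, (a K j * (starRingEnd ℂ) (b K j)).re

theorem hasSum_pair (hL : 0 < L) (u v : L2 L) :
    HasSum (pair (coeff u) (coeff v)) (inner ℝ u v / L ^ 3) := by
  rw [real_inner_comm]
  refine (hasSum_re_conj_coeff_mul hL v u).congr_fun fun K => ?_
  exact Finset.sum_congr rfl fun j _ => by rw [mul_comm]

theorem pair_self (u : L2 L) (K : Fin 3 → ℤ) : pair (coeff u) (coeff u) K = amp u K := by
  refine Finset.sum_congr rfl fun j _ => ?_
  rw [mul_comm, ← Complex.normSq_eq_conj_mul_self, Complex.ofReal_re, Complex.normSq_eq_norm_sq]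

theorem abs_pair_le (a b : Coeffs) (K : Fin 3 → ℤ) :
    |pair a b K| ≤ Real.sqrt (∑ j, ‖a K j‖ ^ 2) * Real.sqrt (∑ j, ‖b K j‖ ^ 2) := by
  refine le_trans ?_ (Real.sum_mul_le_sqrt_mul_sqrt _ _ _)
  refine (Finset.abs_sum_le_sum_abs _ _).trans (Finset.sum_le_sum fun j _ => ?_)
  refine (Complex.abs_re_le_norm _).trans_eq ?_
  rw [norm_mul, RCLike.norm_conj]

theorem pair_coeff_sub_left (u u' v : L2 L) (K : Fin 3 → ℤ) :
    pair (coeff (u - u')) (coeff v) K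
      = pair (coeff u) (coeff v) K - pair (coeff u') (coeff v) K := by
  simp only [pair, ← Finset.sum_sub_distrib, coeff_sub, sub_mul, Complex.sub_re]

/-- The Leray projection is invisible against a divergence-free mean-free field. -/
theorem MemV.pair_leray {s : ℕ} {g : L2 L} (hg : MemV L s g) (a : Coeffs) (K : Fin 3 → ℤ) :
    pair (leray a) (coeff g) K = pair a (coeff g) K := by
  by_cases hK : K = 0
  · simp [pair, hK, hg.mean_zero]
  · have h : ∑ j, (K j : ℂ) * (starRingEnd ℂ) (coeff g K j) = 0 := by
      have := congrArg (starRingEnd ℂ) (hg.div_free K)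
      simpa only [map_sum, map_mul, map_zero, map_intCast] using this
    have e : ∑ j, leray a K j * (starRingEnd ℂ) (coeff g K j)
        = ∑ j, a K j * (starRingEnd ℂ) (coeff g K j)
          - (∑ i, a K i * (K i : ℂ)) / (freqSq K : ℂ)
            * ∑ j, (K j : ℂ) * (starRingEnd ℂ) (coeff g K j) := by
      rw [Finset.mul_sum, ← Finset.sum_sub_distrib]
      refine Finset.sum_congr rfl fun j _ => ?_
      simp only [leray, if_neg hK]
      ring
    rw [h, mul_zero, sub_zero] at e
    unfold pair
    rw [← Complex.re_sum, ← Complex.re_sum, e]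

/-- The evolution equation tested, frequency by frequency, with a mean-free
divergence-free field. -/
theorem pair_equation {s : ℕ} {ν α : ℝ} {u u' g : L2 L} {F : Coeffs} (hg : MemV L s g)
    (h : helmholtz L α (coeff u') + (ν : ℂ) • stokes L (helmholtz L α (coeff u)) + bilin u u = F)
    (K : Fin 3 → ℤ) :
    (1 + α ^ 2 * eigen L K) * (pair (coeff u') (coeff g) K
      + ν * eigen L K * pair (coeff u) (coeff g) K) + pair (advect u u) (coeff g) K
      = pair F (coeff g) K := by
  rw [← hg.pair_leray (advect u u), ← h]
  unfold pair
  rw [Finset.mul_sum, ← Finset.sum_add_distrib, Finset.mul_sum, ← Finset.sum_add_distrib]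
  refine Finset.sum_congr rfl fun j _ => ?_
  have e : (helmholtz L α (coeff u') + (ν : ℂ) • stokes L (helmholtz L α (coeff u)) + bilin u u) K j
      * (starRingEnd ℂ) (coeff g K j)
      = ((1 + α ^ 2 * eigen L K : ℝ) : ℂ) * (coeff u' K j * (starRingEnd ℂ) (coeff g K j)
          + ((ν * eigen L K : ℝ) : ℂ) * (coeff u K j * (starRingEnd ℂ) (coeff g K j)))
        + leray (advect u u) K j * (starRingEnd ℂ) (coeff g K j) := by
    simp only [Pi.add_apply, Pi.smul_apply, smul_eq_mul, helmholtz, stokes, bilin]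
    push_cast
    ring
  rw [e, Complex.add_re, Complex.re_ofReal_mul, Complex.add_re, Complex.re_ofReal_mul]

theorem MemV.hasSum_eigen (hL : 0 < L) {s s' : ℕ} {u : L2 L} (hu : MemV L s u) (h : s' ≤ s) :
    HasSum (fun K => eigen L K ^ s' * amp u K) (hNorm s' u ^ 2 / L ^ 3) := by
  have := (hu.summable_eigen h).hasSum
  rw [hNorm_sq hL]
  convert this using 1
  field_simp

/-- The energy balance of the simplified Bardina model. -/
theorem hasSum_energy_bardina (hL : 0 < L) {ν α : ℝ} {u u' f : L2 L} (hu : MemV L 2 u)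
    (h : helmholtz L α (coeff u') + (ν : ℂ) • stokes L (helmholtz L α (coeff u)) + bilin u u
      = coeff f) :
    HasSum (fun K => (1 + α ^ 2 * eigen L K) * pair (coeff u') (coeff u) K)
      ((inner ℝ f u - ν * (hNorm 1 u ^ 2 + α ^ 2 * hNorm 2 u ^ 2)) / L ^ 3) := by
  have h0 := Complex.hasSum_re (hasSum_advect_mul hL hu (hu.of_le one_le_two) u)
  rw [re_tsum_triTerm_self hu u] at h0
  have h1 := hu.hasSum_eigen hL (s' := 1) one_le_two
  have h2 := hu.hasSum_eigen hL (s' := 2) le_rfl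
  have h3 := ((hasSum_pair hL f u).sub ((h1.add (h2.mul_left (α ^ 2))).mul_left ν)).sub h0
  have e0 : (inner ℝ f u - ν * (hNorm 1 u ^ 2 + α ^ 2 * hNorm 2 u ^ 2)) / L ^ 3
      = inner ℝ f u / L ^ 3 - ν * (hNorm 1 u ^ 2 / L ^ 3 + α ^ 2 * (hNorm 2 u ^ 2 / L ^ 3)) - 0 := by
    ring
  rw [e0]
  refine h3.congr_fun fun K => ?_
  have := pair_equation hu h K
  rw [pair_self] at this
  have e : pair (advect u u) (coeff u) K
      = (∑ j, advect u u K j * (starRingEnd ℂ) (coeff u K j)).re := (Complex.re_sum _ _).symm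
  rw [← e]
  linarith

/-- The energy balance of the difference `g = w - u` of the two solutions. The model error
`(β² - α²) A (du/dt + ν A u)` is expressed through
`du/dt + ν A u = (I + α² A)⁻¹ (f - B(u, u))`, and is of order zero in `f` and `u ⊗ u`. -/
theorem hasSum_energy_difference (hL : 0 < L) {ν α β η : ℝ} (hα : 0 < α) {u u' w w' f p : L2 L}
    (hu : MemV L 2 u) (hw : MemV L 2 w) (hg : MemV L 2 (w - u))
    (hTu : Summable (tensorSq u)) (hTg : Summable (tensorSq (w - u)))
    (h : helmholtz L α (coeff u') + (ν : ℂ) • stokes L (helmholtz L α (coeff u)) + bilin u u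
      = coeff f)
    (h' : helmholtz L β (coeff w') + (ν : ℂ) • stokes L (helmholtz L β (coeff w)) + bilin w w
      = coeff f - (η : ℂ) • leray (coeff p)) :
    ∃ d, HasSum (fun K => (1 + β ^ 2 * eigen L K) * pair (coeff (w' - u')) (coeff (w - u)) K) d ∧
      L ^ 3 * d ≤ -ν * (hNorm 1 (w - u) ^ 2 + β ^ 2 * hNorm 2 (w - u) ^ 2)
        + |β ^ 2 - α ^ 2| * (Real.sqrt (2 * ‖f‖ ^ 2 + (L ^ 3 * ∑' K, tensorSq u K) / (2 * α ^ 2))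
          * hNorm 2 (w - u))
        + hNorm 1 u * Real.sqrt (L ^ 3 * ∑' K, tensorSq (w - u) K)
        - η * inner ℝ p (w - u) := by
  set g := w - u with hgdef
  have hL3 : 0 < L ^ 3 := by positivity
  -- `(w · ∇) w - (u · ∇) u = (w · ∇) g + (g · ∇) u`, and the first summand is orthogonal to `g`
  have n1 := Complex.hasSum_re (hasSum_advect_mul hL hw (hg.of_le one_le_two) g)
  have n2 := Complex.hasSum_re (hasSum_advect_mul hL hg (hu.of_le one_le_two) g)
  rw [re_tsum_triTerm_self hw g] at n1
  have n3 := n1.add n2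
  rw [zero_add] at n3
  have n4 : L ^ 3 * -(∑' q, triTerm g u g q).re ≤ hNorm 1 u *
      Real.sqrt (L ^ 3 * ∑' K, tensorSq g K) := by
    refine le_trans ?_ (norm_tsum_triTerm_le hL hg (hu.of_le one_le_two) hTg)
    refine mul_le_mul_of_nonneg_left ?_ hL3.le
    exact (neg_le_abs _).trans (Complex.abs_re_le_norm _)
  -- `r` is the density of `⟪A (I + α² A)⁻¹ (f - B(u, u)), g⟫`; it is bounded by `x y`, where `y` is
  -- the density of `‖A g‖` and `x` is of order zero in `f` and `u ⊗ u`
  set r : (Fin 3 → ℤ) → ℝ := fun K => eigen L K / (1 + α ^ 2 * eigen L K) *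
    (pair (coeff f) (coeff g) K - pair (advect u u) (coeff g) K) with hr
  set x : (Fin 3 → ℤ) → ℝ := fun K => Real.sqrt (amp f K) + Real.sqrt (tensorSq u K) / (2 * α)
    with hx
  set y : (Fin 3 → ℤ) → ℝ := fun K => eigen L K * Real.sqrt (amp g K) with hy
  have r1 : ∀ K, |r K| ≤ x K * y K := fun K => by
    have hl := eigen_nonneg L K
    have hd : 0 < 1 + α ^ 2 * eigen L K := by positivity
    have b1 : |pair (coeff f) (coeff g) K| ≤ Real.sqrt (amp f K) * Real.sqrt (amp g K) :=
      abs_pair_le _ _ K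
    have b2 : |pair (advect u u) (coeff g) K|
        ≤ Real.sqrt (eigen L K) * Real.sqrt (tensorSq u K) * Real.sqrt (amp g K) := by
      refine (abs_pair_le _ _ K).trans ?_
      rw [← Real.sqrt_mul hl]
      exact mul_le_mul_of_nonneg_right (Real.sqrt_le_sqrt (norm_advect_sq_le hL hu K))
        (Real.sqrt_nonneg _)
    -- `2 α λ^{1/2} ≤ 1 + α² λ`
    have b3 : Real.sqrt (eigen L K) ≤ (1 + α ^ 2 * eigen L K) / (2 * α) := by
      rw [le_div_iff₀ (by positivity)]
      nlinarith [sq_nonneg (1 - α * Real.sqrt (eigen L K)), Real.sq_sqrt hl]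
    have b4 : (1 : ℝ) ≤ 1 + α ^ 2 * eigen L K := by
      have : 0 ≤ α ^ 2 * eigen L K := by positivity
      linarith
    have b5 : |pair (coeff f) (coeff g) K - pair (advect u u) (coeff g) K|
        ≤ (1 + α ^ 2 * eigen L K) * (x K * Real.sqrt (amp g K)) := by
      calc _ ≤ |pair (coeff f) (coeff g) K| + |pair (advect u u) (coeff g) K| := abs_sub _ _
        _ ≤ 1 * (Real.sqrt (amp f K) * Real.sqrt (amp g K))
          + Real.sqrt (eigen L K) * Real.sqrt (tensorSq u K) * Real.sqrt (amp g K) := by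
            rw [one_mul]; exact add_le_add b1 b2
        _ ≤ (1 + α ^ 2 * eigen L K) * (Real.sqrt (amp f K) * Real.sqrt (amp g K))
          + (1 + α ^ 2 * eigen L K) / (2 * α) * Real.sqrt (tensorSq u K) * Real.sqrt (amp g K) := by
            gcongr
        _ = _ := by simp only [hx]; ring
    rw [hr]
    simp only
    rw [abs_mul, abs_of_nonneg (div_nonneg hl hd.le), div_mul_eq_mul_div, div_le_iff₀ hd]
    calc _ ≤ eigen L K * ((1 + α ^ 2 * eigen L K) * (x K * Real.sqrt (amp g K))) :=
          mul_le_mul_of_nonneg_left b5 hl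
      _ = _ := by simp only [hy]; ring
  have x1 : ∀ K, x K ^ 2 ≤ 2 * amp f K + tensorSq u K / (2 * α ^ 2) := fun K => by
    have s1 := Real.sq_sqrt (amp_nonneg f K)
    have s2 := Real.sq_sqrt (tensorSq_nonneg u K)
    calc x K ^ 2 ≤ 2 * (Real.sqrt (amp f K) ^ 2 + (Real.sqrt (tensorSq u K) / (2 * α)) ^ 2) :=
          add_sq_le
      _ = _ := by rw [div_pow, s1, s2]; ring
  have x2 : Summable fun K => 2 * amp f K + tensorSq u K / (2 * α ^ 2) :=
    ((summable_amp hL f).mul_left 2).add (hTu.div_const _)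
  have x3 : Summable fun K => x K ^ 2 := x2.of_nonneg_of_le (fun _ => sq_nonneg _) x1
  have y1 : ∀ K, y K ^ 2 = eigen L K ^ 2 * amp g K := fun K => by
    simp only [hy, mul_pow, Real.sq_sqrt (amp_nonneg g K)]
  have y2 : Summable fun K => y K ^ 2 := (hg.summable_eigen le_rfl).congr fun K => (y1 K).symm
  obtain ⟨s1, s2⟩ := summable_mul_and_abs_tsum_le x3 y2
  have r2 : Summable r := Summable.of_norm_bounded s1 r1
  have r3 : L ^ 3 * |∑' K, r K| ≤ Real.sqrt (2 * ‖f‖ ^ 2 + (L ^ 3 * ∑' K, tensorSq u K) / (2 * α ^ 2))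
      * hNorm 2 g := by
    have t1 : |∑' K, r K| ≤ ∑' K, x K * y K := tsum_of_norm_bounded (f := r) s1.hasSum r1
    have t2 : ∑' K, x K ^ 2 ≤ 2 * (∑' K, amp f K) + (∑' K, tensorSq u K) / (2 * α ^ 2) := by
      rw [← tsum_mul_left, ← tsum_div_const, ← ((summable_amp hL f).mul_left 2).tsum_add
        (hTu.div_const _)]
      exact x3.tsum_le_tsum x1 x2
    have t3 : hNorm 2 g = Real.sqrt (L ^ 3) * Real.sqrt (∑' K, y K ^ 2) := by
      rw [← Real.sqrt_mul hL3.le, tsum_congr y1]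
      rfl
    have t4 : Real.sqrt (L ^ 3) * Real.sqrt (∑' K, x K ^ 2)
        ≤ Real.sqrt (2 * ‖f‖ ^ 2 + (L ^ 3 * ∑' K, tensorSq u K) / (2 * α ^ 2)) := by
      rw [← Real.sqrt_mul hL3.le, norm_sq_eq hL]
      refine Real.sqrt_le_sqrt ?_
      calc _ ≤ L ^ 3 * (2 * (∑' K, amp f K) + (∑' K, tensorSq u K) / (2 * α ^ 2)) :=
            mul_le_mul_of_nonneg_left t2 hL3.le
        _ = _ := by ring
    calc L ^ 3 * |∑' K, r K| ≤ L ^ 3 * (Real.sqrt (∑' K, x K ^ 2) * Real.sqrt (∑' K, y K ^ 2)) :=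
          mul_le_mul_of_nonneg_left (t1.trans ((le_abs_self _).trans s2)) hL3.le
      _ = (Real.sqrt (L ^ 3) * Real.sqrt (L ^ 3)) *
          (Real.sqrt (∑' K, x K ^ 2) * Real.sqrt (∑' K, y K ^ 2)) := by
          rw [Real.mul_self_sqrt hL3.le]
      _ = (Real.sqrt (L ^ 3) * Real.sqrt (∑' K, x K ^ 2)) * hNorm 2 g := by rw [t3]; ring
      _ ≤ _ := mul_le_mul_of_nonneg_right t4 (hNorm_nonneg 2 g)
  have h1 := hg.hasSum_eigen hL (s' := 1) one_le_two
  have h2 := hg.hasSum_eigen hL (s' := 2) le_rfl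
  have key := ((((h1.add (h2.mul_left (β ^ 2))).mul_left (-ν)).sub
    (r2.hasSum.mul_left (β ^ 2 - α ^ 2))).sub n3).sub ((hasSum_pair hL p g).mul_left η)
  refine ⟨_, key.congr_fun fun K => ?_, ?_⟩
  · have q1 := pair_equation hg h K
    have q2 := pair_equation hg h' K
    have q3 : pair (coeff f - (η : ℂ) • leray (coeff p)) (coeff g) K
        = pair (coeff f) (coeff g) K - η * pair (coeff p) (coeff g) K := by
      rw [← hg.pair_leray (coeff p)]
      unfold pair
      rw [Finset.mul_sum, ← Finset.sum_sub_distrib]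
      refine Finset.sum_congr rfl fun j _ => ?_
      rw [← Complex.re_ofReal_mul, ← Complex.sub_re]
      congr 1
      simp only [Pi.sub_apply, Pi.smul_apply, smul_eq_mul]
      ring
    rw [q3] at q2
    have q4 : pair (advect w w) (coeff g) K - pair (advect u u) (coeff g) K
        = (∑ j, advect w g K j * (starRingEnd ℂ) (coeff g K j)).re
          + (∑ j, advect g u K j * (starRingEnd ℂ) (coeff g K j)).re := by
      unfold pair
      rw [← Finset.sum_sub_distrib, Complex.re_sum, Complex.re_sum, ← Finset.sum_add_distrib]
      refine Finset.sum_congr rfl fun j _ => ?_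
      rw [← Complex.sub_re, ← Complex.add_re, ← sub_mul, ← add_mul,
        advect_self_sub_advect_self hL hu hw hg]
    have q5 : amp g K = pair (coeff w) (coeff g) K - pair (coeff u) (coeff g) K := by
      rw [← pair_coeff_sub_left, ← pair_self]
    have hd : (1 + α ^ 2 * eigen L K) ≠ 0 := by
      have := eigen_nonneg L K
      positivity
    have q6 : r K = eigen L K * (pair (coeff u') (coeff g) K
        + ν * eigen L K * pair (coeff u) (coeff g) K) := by
      simp only [hr]
      rw [← q1, add_sub_cancel_right, div_mul_eq_mul_div, mul_left_comm, mul_div_cancel_left₀ _ hd]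
    rw [← q4, q6, q5, pair_coeff_sub_left]
    linear_combination q2 - q1
  · have hk : L ^ 3 * -((β ^ 2 - α ^ 2) * ∑' K, r K) ≤ |β ^ 2 - α ^ 2| *
        (Real.sqrt (2 * ‖f‖ ^ 2 + (L ^ 3 * ∑' K, tensorSq u K) / (2 * α ^ 2)) * hNorm 2 g) := by
      calc L ^ 3 * -((β ^ 2 - α ^ 2) * ∑' K, r K) ≤ L ^ 3 * (|β ^ 2 - α ^ 2| * |∑' K, r K|) := by
            rw [← abs_mul]
            exact mul_le_mul_of_nonneg_left (neg_le_abs _) hL3.le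
        _ = |β ^ 2 - α ^ 2| * (L ^ 3 * |∑' K, r K|) := by ring
        _ ≤ _ := mul_le_mul_of_nonneg_left r3 (abs_nonneg _)
    have e : L ^ 3 * (-ν * (hNorm 1 g ^ 2 / L ^ 3 + β ^ 2 * (hNorm 2 g ^ 2 / L ^ 3))
        - (β ^ 2 - α ^ 2) * ∑' K, r K - (∑' q, triTerm g u g q).re - η * (inner ℝ p g / L ^ 3))
        = -ν * (hNorm 1 g ^ 2 + β ^ 2 * hNorm 2 g ^ 2) + L ^ 3 * -((β ^ 2 - α ^ 2) * ∑' K, r K)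
          + L ^ 3 * -(∑' q, triTerm g u g q).re - η * inner ℝ p g := by
      field_simp
      ring
    rw [e]
    linarith

/-! ### Differences of fields, and inequalities between real numbers -/

theorem amp_sub_le (u v : L2 L) (K : Fin 3 → ℤ) : amp (u - v) K ≤ 2 * amp u K + 2 * amp v K := by
  unfold amp
  rw [Finset.mul_sum, Finset.mul_sum, ← Finset.sum_add_distrib]
  refine Finset.sum_le_sum fun j _ => ?_
  rw [coeff_sub]
  have := norm_sub_le (coeff u K j) (coeff v K j)
  nlinarith [norm_nonneg (coeff u K j - coeff v K j),
    sq_nonneg (‖coeff u K j‖ - ‖coeff v K j‖)]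

theorem MemV.sub {s : ℕ} {u v : L2 L} (hu : MemV L s u) (hv : MemV L s v) : MemV L s (u - v) := by
  refine ⟨fun j => by rw [coeff_sub, hu.mean_zero, hv.mean_zero, sub_zero], fun K => ?_, ?_⟩
  · simp only [coeff_sub, mul_sub, Finset.sum_sub_distrib, hu.div_free, hv.div_free, sub_zero]
  · refine Summable.of_nonneg_of_le (fun K => mul_nonneg (pow_nonneg (freqSq_nonneg K) _)
      (amp_nonneg _ K)) (fun K => ?_) ((hu.summable.mul_left 2).add (hv.summable.mul_left 2))
    calc freqSq K ^ s * amp (u - v) K ≤ freqSq K ^ s * (2 * amp u K + 2 * amp v K) :=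
          mul_le_mul_of_nonneg_left (amp_sub_le u v K) (pow_nonneg (freqSq_nonneg K) _)
      _ = 2 * (freqSq K ^ s * amp u K) + 2 * (freqSq K ^ s * amp v K) := by ring

theorem MemV.hNorm_sub_sq_le (hL : 0 < L) {s : ℕ} {u v : L2 L} (hu : MemV L s u)
    (hv : MemV L s v) : hNorm s (u - v) ^ 2 ≤ 2 * hNorm s u ^ 2 + 2 * hNorm s v ^ 2 := by
  have h1 := hu.summable_eigen le_rfl
  have h2 := hv.summable_eigen le_rfl
  rw [hNorm_sq hL, hNorm_sq hL, hNorm_sq hL, mul_left_comm 2, mul_left_comm 2, ← mul_add,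
    ← h1.tsum_mul_left 2, ← h2.tsum_mul_left 2, ← (h1.mul_left 2).tsum_add (h2.mul_left 2)]
  refine mul_le_mul_of_nonneg_left (((hu.sub hv).summable_eigen le_rfl).tsum_le_tsum (fun K => ?_)
    ((h1.mul_left 2).add (h2.mul_left 2))) (by positivity)
  calc eigen L K ^ s * amp (u - v) K ≤ eigen L K ^ s * (2 * amp u K + 2 * amp v K) :=
        mul_le_mul_of_nonneg_left (amp_sub_le u v K) (pow_nonneg (eigen_nonneg L K) _)
    _ = _ := by ring

/-- The dissipation inequality of the simplified Bardina model. -/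
theorem bardina_dissipation {ν α lam x y z F S ip : ℝ} (hν : 0 < ν) (hlam : 0 < lam)
    (hip : ip ≤ F * x) (hF : F ^ 2 ≤ S) (hxy : lam * x ^ 2 ≤ y ^ 2) :
    2 * (ip - ν * (y ^ 2 + α ^ 2 * z ^ 2)) ≤ -ν * (y ^ 2 + α ^ 2 * z ^ 2) + S / (ν * lam) := by
  have h1 : 2 * (F * x) ≤ F ^ 2 / (ν * lam) + ν * lam * x ^ 2 := by
    rw [← sub_nonneg]
    have : F ^ 2 / (ν * lam) + ν * lam * x ^ 2 - 2 * (F * x) = (F - ν * lam * x) ^ 2 / (ν * lam) := by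
      field_simp
      ring
    rw [this]
    positivity
  have h2 : F ^ 2 / (ν * lam) ≤ S / (ν * lam) := by gcongr
  have h3 : ν * lam * x ^ 2 ≤ ν * y ^ 2 := by
    rw [mul_assoc]
    exact mul_le_mul_of_nonneg_left hxy hν.le
  have h4 : 0 ≤ ν * (α ^ 2 * z ^ 2) := by positivity
  linarith

/-- The weighted arithmetic-geometric mean inequality with weights `3/4` and `1/4`. -/
theorem amgm_three_one {P Q : ℝ} (hP : 0 ≤ P) (hQ : 0 ≤ Q) : 256 * (P ^ 3 * Q) ≤ (3 * P + Q) ^ 4 := by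
  have h : (3 * P + Q) ^ 4 - 256 * (P ^ 3 * Q) = (P - Q) ^ 2 * (81 * P ^ 2 + 14 * (P * Q) + Q ^ 2) := by
    ring
  have : 0 ≤ (P - Q) ^ 2 * (81 * P ^ 2 + 14 * (P * Q) + Q ^ 2) := by positivity
  linarith

/-- The trilinear term `∫ (g · ∇) u · g` is absorbed by the viscosity and by the nudging. -/
theorem trilinear_absorbed {ν α η c κ M n y q Q : ℝ} (hν : 0 < ν) (hα : 0 < α)
    (hκc : κ ^ 2 ≤ 27 * c ^ 4) (hq : 0 ≤ q) (hQ0 : 0 ≤ Q)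
    (hQ : Q ≤ κ * n * y ^ 3) (hq2 : α ^ 2 * q ^ 2 ≤ M)
    (hη : 27 * c ^ 4 / 16 * (3 / ν) ^ 3 * (M ^ 2 / α ^ 4) < η) :
    q * Real.sqrt Q ≤ ν / 2 * y ^ 2 + η / 2 * n ^ 2 := by
  have hη0 : 0 < η := lt_of_le_of_lt (by positivity) hη
  have h1 : q ^ 2 ≤ M / α ^ 2 := by
    rw [le_div_iff₀ (by positivity)]
    linarith
  refine (pow_le_pow_iff_left₀ (by positivity) (by positivity) (show (4 : ℕ) ≠ 0 by norm_num)).1 ?_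
  have h2 := amgm_three_one (P := ν * y ^ 2 / 6) (Q := η * n ^ 2 / 2) (by positivity) (by positivity)
  have e : 3 * (ν * y ^ 2 / 6) + η * n ^ 2 / 2 = ν / 2 * y ^ 2 + η / 2 * n ^ 2 := by ring
  rw [e] at h2
  refine le_trans ?_ h2
  have h3 : (q * Real.sqrt Q) ^ 4 = (q ^ 2) ^ 2 * Q ^ 2 := by
    rw [mul_pow, show Real.sqrt Q ^ 4 = (Real.sqrt Q ^ 2) ^ 2 by ring, Real.sq_sqrt hQ0]
    ring
  rw [h3]
  calc (q ^ 2) ^ 2 * Q ^ 2 ≤ (M / α ^ 2) ^ 2 * (κ * n * y ^ 3) ^ 2 := by gcongr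
    _ = κ ^ 2 * ((M / α ^ 2) ^ 2 * (n * y ^ 3) ^ 2) := by ring
    _ ≤ 27 * c ^ 4 * ((M / α ^ 2) ^ 2 * (n * y ^ 3) ^ 2) := by gcongr
    _ = (27 * c ^ 4 / 16 * (3 / ν) ^ 3 * (M ^ 2 / α ^ 4)) *
        (16 / 27 * ν ^ 3 * (y ^ 6 * n ^ 2)) := by
      field_simp
      ring
    _ ≤ η * (16 / 27 * ν ^ 3 * (y ^ 6 * n ^ 2)) := by gcongr
    _ = 256 * ((ν * y ^ 2 / 6) ^ 3 * (η * n ^ 2 / 2)) := by ring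

/-- The dissipation inequality of the difference of the two solutions. -/
theorem difference_dissipation {ν α β η c κ M c₁ c₂ h lam n y z q Q W ip D d : ℝ} (hν : 0 < ν)
    (hα : 0 < α) (hβ : 0 < β) (hκc : κ ^ 2 ≤ 27 * c ^ 4)
    (hq : 0 ≤ q) (hQ0 : 0 ≤ Q) (hQ : Q ≤ κ * n * y ^ 3)
    (hq2 : α ^ 2 * q ^ 2 ≤ M) (hW : 0 ≤ W)
    (hη : 27 * c ^ 4 / 16 * (3 / ν) ^ 3 * (M ^ 2 / α ^ 4) < η)
    (hh₁ : 2 * η * c₁ * h ^ 2 < ν) (hh₂ : 2 * η * c₂ * h ^ 4 < ν * β ^ 2)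
    (hlam1 : lam * n ^ 2 ≤ y ^ 2) (hlam2 : lam * y ^ 2 ≤ z ^ 2)
    (hip : n ^ 2 / 2 - (c₁ * h ^ 2 * y ^ 2 + c₂ * h ^ 4 * z ^ 2) / 2 ≤ ip)
    (hd : d ≤ -ν * (y ^ 2 + β ^ 2 * z ^ 2) + |D| * (Real.sqrt W * z) + q * Real.sqrt Q - η * ip) :
    2 * d ≤ -(lam * ν / 2) * (n ^ 2 + β ^ 2 * y ^ 2) + D ^ 2 / (ν * β ^ 2) * W := by
  have hη0 : 0 < η := lt_of_le_of_lt (by positivity) hη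
  have h1 := trilinear_absorbed hν hα hκc hq hQ0 hQ hq2 hη
  have h2 : |D| * (Real.sqrt W * z) ≤ ν * β ^ 2 / 2 * z ^ 2 + D ^ 2 / (ν * β ^ 2) * W / 2 := by
    have e : ν * β ^ 2 / 2 * z ^ 2 + D ^ 2 / (ν * β ^ 2) * W / 2 - |D| * (Real.sqrt W * z)
        = (ν * β ^ 2 * z - |D| * Real.sqrt W) ^ 2 / (2 * (ν * β ^ 2)) := by
      have s1 := Real.sq_sqrt hW
      have s2 := sq_abs D
      rw [← s2]
      nth_rw 1 [← s1]
      field_simp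
      ring
    have : 0 ≤ (ν * β ^ 2 * z - |D| * Real.sqrt W) ^ 2 / (2 * (ν * β ^ 2)) := by positivity
    linarith
  have h3 : η * (n ^ 2 / 2) - ν / 4 * y ^ 2 - ν * β ^ 2 / 4 * z ^ 2 ≤ η * ip := by
    have a1 := mul_le_mul_of_nonneg_left hip hη0.le
    have a2 : 2 * η * c₁ * h ^ 2 * y ^ 2 ≤ ν * y ^ 2 :=
      mul_le_mul_of_nonneg_right hh₁.le (sq_nonneg y)
    have a3 : 2 * η * c₂ * h ^ 4 * z ^ 2 ≤ ν * β ^ 2 * z ^ 2 :=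
      mul_le_mul_of_nonneg_right hh₂.le (sq_nonneg z)
    nlinarith
  have h4 : ν / 2 * (lam * n ^ 2) ≤ ν / 2 * y ^ 2 := by gcongr
  have h5 : ν / 2 * β ^ 2 * (lam * y ^ 2) ≤ ν / 2 * β ^ 2 * z ^ 2 := by gcongr
  nlinarith

/-- The size of the model error, split between the dissipation of the Bardina energy and
a constant. -/
theorem model_error_le {ν α c M S x y F Q : ℝ} (hν : 0 < ν) (hα : 0 < α)
    (hx : 0 ≤ x) (hy : 0 ≤ y) (hM : x ^ 2 + α ^ 2 * y ^ 2 ≤ M) (hF : F ^ 2 ≤ S)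
    (hQ : Q ≤ c ^ 4 * x * y ^ 3) :
    (2 * F ^ 2 + Q / (2 * α ^ 2)) / ν ≤ 2 * S / ν + 3 / 8 * (ν * y ^ 2 / α ^ 2)
      + 1 / 8 * (c ^ 16 * M ^ 5 / (ν ^ 7 * α ^ 8)) := by
  have hM0 : 0 ≤ M := le_trans (by positivity) hM
  have hx2 : x ^ 2 ≤ M := by nlinarith [sq_nonneg (α * y)]
  have hy2 : α ^ 2 * y ^ 2 ≤ M := by nlinarith [sq_nonneg x]
  -- with `s = c⁴ x y / ν²` the cubic term is `ν y² s`, and `s ≤ (3 + s⁴) / 4`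
  set s := c ^ 4 * x * y / ν ^ 2 with hs
  have hs0 : 0 ≤ s := by positivity
  have h1 : 4 * s ≤ 3 + s ^ 4 := by nlinarith [sq_nonneg (s ^ 2 - 1), sq_nonneg (s - 1)]
  have h2 : Q / (2 * α ^ 2) / ν ≤ ν * y ^ 2 / α ^ 2 * (s / 2) := by
    calc Q / (2 * α ^ 2) / ν ≤ (c ^ 4 * x * y ^ 3) / (2 * α ^ 2) / ν := by gcongr
      _ = _ := by rw [hs]; field_simp
  have h3 : ν * y ^ 2 / α ^ 2 * (s / 2) ≤ ν * y ^ 2 / α ^ 2 * ((3 + s ^ 4) / 8) := by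
    have : s / 2 ≤ (3 + s ^ 4) / 8 := by linarith
    gcongr
  have h4 : ν * y ^ 2 / α ^ 2 * s ^ 4 ≤ c ^ 16 * M ^ 5 / (ν ^ 7 * α ^ 8) := by
    have e : ν * y ^ 2 / α ^ 2 * s ^ 4
        = c ^ 16 * ((x ^ 2) ^ 2 * (α ^ 2 * y ^ 2) ^ 3) / (ν ^ 7 * α ^ 8) := by
      rw [hs]
      field_simp
    rw [e]
    have : (x ^ 2) ^ 2 * (α ^ 2 * y ^ 2) ^ 3 ≤ M ^ 2 * M ^ 3 := by gcongr
    have e5 : M ^ 2 * M ^ 3 = M ^ 5 := by ring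
    rw [e5] at this
    gcongr
  have h5 : 2 * F ^ 2 / ν ≤ 2 * S / ν := by gcongr
  rw [add_div]
  linarith

/-! ### Product rule and Grönwall inequality -/

/-- The product rule, in integrated form, for two primitives of integrable functions. -/
theorem integral_mul_add_mul_eq_sub {F₁ F₂ f₁ f₂ : ℝ → ℝ} {T : ℝ} (hT : 0 ≤ T)
    (h₁ : IntervalIntegrable f₁ volume 0 T) (h₂ : IntervalIntegrable f₂ volume 0 T)
    (e₁ : ∀ t ∈ Set.Icc 0 T, F₁ t = F₁ 0 + ∫ s in (0 : ℝ)..t, f₁ s)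
    (e₂ : ∀ t ∈ Set.Icc 0 T, F₂ t = F₂ 0 + ∫ s in (0 : ℝ)..t, f₂ s) :
    IntervalIntegrable (fun t => f₁ t * F₂ t + F₁ t * f₂ t) volume 0 T ∧
      ∫ t in (0 : ℝ)..T, (f₁ t * F₂ t + F₁ t * f₂ t) = F₁ T * F₂ T - F₁ 0 * F₂ 0 := by
  have mem0 : (0 : ℝ) ∈ Set.uIcc 0 T := Set.left_mem_uIcc
  set G₁ : ℝ → ℝ := fun t => F₁ 0 + ∫ s in (0 : ℝ)..t, f₁ s with hG₁
  set G₂ : ℝ → ℝ := fun t => F₂ 0 + ∫ s in (0 : ℝ)..t, f₂ s with hG₂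
  have ac : ∀ (a : ℝ) {f : ℝ → ℝ}, IntervalIntegrable f volume 0 T →
      AbsolutelyContinuousOnInterval (fun t => a + ∫ s in (0 : ℝ)..t, f s) 0 T := fun a f hf => by
    have hc : AbsolutelyContinuousOnInterval (fun _ : ℝ => a) 0 T :=
      LipschitzOnWith.absolutelyContinuousOnInterval (K := 0) (LipschitzWith.const a).lipschitzOnWith
    exact hc.add (hf.absolutelyContinuousOnInterval_intervalIntegral mem0)
  have a₁ := ac (F₁ 0) h₁
  have a₂ := ac (F₂ 0) h₂
  have key := a₁.integral_deriv_mul_eq_sub a₂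
  have hG0 : G₁ 0 = F₁ 0 ∧ G₂ 0 = F₂ 0 := by simp [hG₁, hG₂]
  have eq : ∀ t ∈ Set.uIoc 0 T, F₁ t = G₁ t ∧ F₂ t = G₂ t := fun t ht => by
    rw [Set.uIoc_of_le hT] at ht
    exact ⟨e₁ t ⟨ht.1.le, ht.2⟩, e₂ t ⟨ht.1.le, ht.2⟩⟩
  have i1 : IntervalIntegrable (fun t => f₁ t * F₂ t + F₁ t * f₂ t) volume 0 T := by
    refine ((h₁.mul_continuousOn a₂.continuousOn).add (h₂.continuousOn_mul a₁.continuousOn)).congr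
      ?_
    intro t ht
    simp only
    rw [(eq t ht).1, (eq t ht).2]
  refine ⟨i1, ?_⟩
  have hd : ∫ t in (0 : ℝ)..T, (f₁ t * F₂ t + F₁ t * f₂ t)
      = ∫ t in (0 : ℝ)..T, (deriv G₁ t * G₂ t + G₁ t * deriv G₂ t) := by
    refine intervalIntegral.integral_congr_ae ?_
    filter_upwards [h₁.ae_hasDerivAt_integral, h₂.ae_hasDerivAt_integral] with t k₁ k₂ ht
    have ht' := Set.uIoc_subset_uIcc ht
    rw [(eq t ht).1, (eq t ht).2, ((k₁ ht' 0 mem0).const_add (F₁ 0)).deriv,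
      ((k₂ ht' 0 mem0).const_add (F₂ 0)).deriv]
  rw [hd]
  refine key.trans ?_
  have hT1 := e₁ T ⟨hT, le_rfl⟩
  have hT2 := e₂ T ⟨hT, le_rfl⟩
  change G₁ T * G₂ T - G₁ 0 * G₂ 0 = _
  rw [hG0.1, hG0.2, hT1, hT2]

/-- The Grönwall inequality for an absolutely continuous function. -/
theorem gronwall_of_integral {E e : ℝ → ℝ} {κ C : ℝ} (hκ : 0 < κ)
    (hi : ∀ T, 0 ≤ T → IntervalIntegrable e volume 0 T)
    (hE : ∀ t, 0 ≤ t → E t = E 0 + ∫ s in (0 : ℝ)..t, e s)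
    (h : ∀ᵐ t ∂(volume.restrict (Set.Ici (0 : ℝ))), e t ≤ -κ * E t + C) {T : ℝ} (hT : 0 ≤ T) :
    E T ≤ Real.exp (-κ * T) * E 0 + C / κ * (1 - Real.exp (-κ * T)) := by
  have d : ∀ t : ℝ, HasDerivAt (fun t => Real.exp (κ * t)) (κ * Real.exp (κ * t)) t := fun t => by
    have := ((hasDerivAt_id t).const_mul κ).exp
    simpa [mul_comm] using this
  have hc : Continuous fun t : ℝ => κ * Real.exp (κ * t) := by fun_prop
  have ei : ∀ t, ∫ s in (0 : ℝ)..t, κ * Real.exp (κ * s) = Real.exp (κ * t) - 1 := fun t => by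
    rw [intervalIntegral.integral_eq_sub_of_hasDerivAt (fun s _ => d s) (hc.intervalIntegrable _ _)]
    simp
  obtain ⟨i1, h1⟩ := integral_mul_add_mul_eq_sub (F₁ := fun t => Real.exp (κ * t)) (F₂ := E) hT
    (hc.intervalIntegrable _ _) (hi T hT) (fun t _ => by rw [ei]; simp)
    (fun t ht => hE t ht.1)
  have h2 : ∫ t in (0 : ℝ)..T, (κ * Real.exp (κ * t) * E t + Real.exp (κ * t) * e t)
      ≤ ∫ t in (0 : ℝ)..T, C / κ * (κ * Real.exp (κ * t)) := by
    refine intervalIntegral.integral_mono_ae_restrict hT i1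
      ((hc.intervalIntegrable _ _).const_mul _) ?_
    filter_upwards [ae_restrict_of_ae_restrict_of_subset Set.Icc_subset_Ici_self h] with t ht
    have hp := Real.exp_pos (κ * t)
    have e1 : C / κ * (κ * Real.exp (κ * t)) = Real.exp (κ * t) * C := by
      field_simp
    rw [e1]
    have := mul_le_mul_of_nonneg_left ht hp.le
    linarith
  rw [h1, intervalIntegral.integral_const_mul, ei] at h2
  simp only [mul_zero, Real.exp_zero, one_mul] at h2
  have h3 : Real.exp (-κ * T) * Real.exp (κ * T) = 1 := by
    rw [← Real.exp_add]
    simp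
  have h4 := mul_le_mul_of_nonneg_left h2 (Real.exp_pos (-κ * T)).le
  have e2 : Real.exp (-κ * T) * (Real.exp (κ * T) * E T - E 0)
      = E T - Real.exp (-κ * T) * E 0 := by
    rw [mul_sub, ← mul_assoc, h3, one_mul]
  have e3 : Real.exp (-κ * T) * (C / κ * (Real.exp (κ * T) - 1))
      = C / κ * (1 - Real.exp (-κ * T)) := by
    rw [mul_left_comm, mul_sub, h3, mul_one]
  rw [e2, e3] at h4
  linarith

/-! ### The energy identity -/

/-- Each mode of the energy rate is dominated by the modes of `‖v‖²`, `‖g‖²` and `‖A g‖²`. -/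
theorem abs_weighted_pair_le (γ : ℝ) (v g : L2 L) (K : Fin 3 → ℤ) :
    |2 * (1 + γ ^ 2 * eigen L K) * pair (coeff v) (coeff g) K|
      ≤ amp v K + (2 * amp g K + 2 * γ ^ 4 * (eigen L K ^ 2 * amp g K)) := by
  have h := abs_pair_le (coeff v) (coeff g) K
  have hl := eigen_nonneg L K
  have hw : 0 ≤ 1 + γ ^ 2 * eigen L K := by positivity
  rw [abs_mul, abs_of_nonneg (by positivity)]
  have s1 := Real.sq_sqrt (amp_nonneg v K)
  have s2 := Real.sq_sqrt (amp_nonneg g K)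
  change |pair (coeff v) (coeff g) K| ≤ Real.sqrt (amp v K) * Real.sqrt (amp g K) at h
  calc 2 * (1 + γ ^ 2 * eigen L K) * |pair (coeff v) (coeff g) K|
      ≤ 2 * (1 + γ ^ 2 * eigen L K) * (Real.sqrt (amp v K) * Real.sqrt (amp g K)) := by gcongr
    _ ≤ Real.sqrt (amp v K) ^ 2 + ((1 + γ ^ 2 * eigen L K) * Real.sqrt (amp g K)) ^ 2 := by
        nlinarith [sq_nonneg (Real.sqrt (amp v K) - (1 + γ ^ 2 * eigen L K) * Real.sqrt (amp g K))]
    _ = amp v K + (1 + γ ^ 2 * eigen L K) ^ 2 * amp g K := by rw [mul_pow, s1, s2]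
    _ ≤ amp v K + (2 + 2 * γ ^ 4 * eigen L K ^ 2) * amp g K := by
        refine add_le_add le_rfl (mul_le_mul_of_nonneg_right ?_ (amp_nonneg g K))
        nlinarith [sq_nonneg (1 - γ ^ 2 * eigen L K)]
    _ = _ := by ring

/-- The rate of change `2 ∑ L³ (1 + γ² λ_K) Re (v_K · conj g_K)` of the energy of `g` when
`dg/dt = v`. -/
def energyRate (γ : ℝ) (v g : L2 L) : ℝ :=
  L ^ 3 * ∑' K, 2 * (1 + γ ^ 2 * eigen L K) * pair (coeff v) (coeff g) K

/-- Each Fourier mode of a primitive satisfies the energy identity. -/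
theorem integral_pair_eq (hL : 0 < L) {g g' : ℝ → L2 L} {T : ℝ} (hT : 0 ≤ T)
    (hg' : IntervalIntegrable g' volume 0 T)
    (he : ∀ t ∈ Set.Icc 0 T, g t = g 0 + ∫ s in (0 : ℝ)..t, g' s) (K : Fin 3 → ℤ) :
    IntervalIntegrable (fun t => 2 * pair (coeff (g' t)) (coeff (g t)) K) volume 0 T ∧
      ∫ t in (0 : ℝ)..T, 2 * pair (coeff (g' t)) (coeff (g t)) K = amp (g T) K - amp (g 0) K := by
  have comp : ∀ ℓ : L2 L →L[ℝ] ℝ,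
      IntervalIntegrable (fun t => ℓ (g' t) * ℓ (g t) + ℓ (g t) * ℓ (g' t)) volume 0 T ∧
      ∫ t in (0 : ℝ)..T, (ℓ (g' t) * ℓ (g t) + ℓ (g t) * ℓ (g' t))
        = ℓ (g T) * ℓ (g T) - ℓ (g 0) * ℓ (g 0) := by
    intro ℓ
    have hi : IntervalIntegrable (fun t => ℓ (g' t)) volume 0 T :=
      ⟨ℓ.integrable_comp hg'.1, ℓ.integrable_comp hg'.2⟩
    have e : ∀ t ∈ Set.Icc 0 T, ℓ (g t) = ℓ (g 0) + ∫ s in (0 : ℝ)..t, ℓ (g' s) := fun t ht => by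
      have hsub : IntervalIntegrable g' volume 0 t := hg'.mono_set (by
        rw [Set.uIcc_of_le ht.1, Set.uIcc_of_le hT]
        exact Set.Icc_subset_Icc_right ht.2)
      rw [he t ht, map_add, ← ℓ.intervalIntegral_comp_comm hsub]
    exact integral_mul_add_mul_eq_sub hT hi hi e e
  let re : Fin 3 → L2 L →L[ℝ] ℝ := fun j => Complex.reCLM.comp (coeffL hL K j)
  let im : Fin 3 → L2 L →L[ℝ] ℝ := fun j => Complex.imCLM.comp (coeffL hL K j)
  have hre : ∀ j u, re j u = (coeff u K j).re := fun j u => rfl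
  have him : ∀ j u, im j u = (coeff u K j).im := fun j u => rfl
  have e1 : ∀ t, 2 * pair (coeff (g' t)) (coeff (g t)) K
      = ∑ j, ((re j (g' t) * re j (g t) + re j (g t) * re j (g' t))
        + (im j (g' t) * im j (g t) + im j (g t) * im j (g' t))) := fun t => by
    unfold pair
    rw [Finset.mul_sum]
    refine Finset.sum_congr rfl fun j _ => ?_
    simp only [hre, him, Complex.mul_re, Complex.conj_re, Complex.conj_im]
    ring
  have e2 : ∀ u : L2 L, amp u K = ∑ j, (re j u * re j u + im j u * im j u) := fun u => by
    unfold amp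
    refine Finset.sum_congr rfl fun j _ => ?_
    rw [hre, him, ← Complex.normSq_eq_norm_sq, Complex.normSq_apply]
  have hi : ∀ j ∈ (Finset.univ : Finset (Fin 3)), IntervalIntegrable (fun t =>
      (re j (g' t) * re j (g t) + re j (g t) * re j (g' t))
        + (im j (g' t) * im j (g t) + im j (g t) * im j (g' t))) volume 0 T := fun j _ =>
    (comp (re j)).1.add (comp (im j)).1
  simp only [e1, e2]
  refine ⟨IntervalIntegrable.sum _ hi, ?_⟩
  rw [intervalIntegral.integral_finsetSum hi, ← Finset.sum_sub_distrib]
  refine Finset.sum_congr rfl fun j _ => ?_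
  rw [intervalIntegral.integral_add (comp (re j)).1 (comp (im j)).1, (comp (re j)).2,
    (comp (im j)).2]
  ring

/-- The energy identity for `g ∈ L²(0, T; D(A))` with `dg/dt ∈ L²(0, T; H)`. -/
theorem energy_identity (hL : 0 < L) (γ : ℝ) {g g' : ℝ → L2 L} {b : ℝ → ℝ} {T : ℝ} (hT : 0 ≤ T)
    (hV : ∀ t, 0 ≤ t → MemV L 1 (g t))
    (hDA : ∀ᵐ t ∂(volume.restrict (Set.Icc 0 T)), MemV L 2 (g t) ∧ hNorm 2 (g t) ^ 2 ≤ b t)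
    (hb : IntegrableOn b (Set.Icc 0 T)) (hg' : MemLp g' 2 (volume.restrict (Set.Icc 0 T)))
    (he : ∀ t, 0 ≤ t → g t = g 0 + ∫ s in (0 : ℝ)..t, g' s) :
    IntervalIntegrable (fun t => energyRate γ (g' t) (g t)) volume 0 T ∧
      ‖g T‖ ^ 2 + γ ^ 2 * hNorm 1 (g T) ^ 2 = ‖g 0‖ ^ 2 + γ ^ 2 * hNorm 1 (g 0) ^ 2
        + ∫ t in (0 : ℝ)..T, energyRate γ (g' t) (g t) := by
  have hL3 : 0 < L ^ 3 := by positivity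
  have hg'i : IntervalIntegrable g' volume 0 T :=
    (intervalIntegrable_iff_integrableOn_Icc_of_le hT).2 (hg'.integrable (by norm_num))
  have modes := fun K => integral_pair_eq hL hT hg'i (fun t ht => he t ht.1) K
  set r : (Fin 3 → ℤ) → ℝ → ℝ := fun K t =>
    2 * (1 + γ ^ 2 * eigen L K) * pair (coeff (g' t)) (coeff (g t)) K with hr
  have hrw : ∀ K, r K = fun t => (1 + γ ^ 2 * eigen L K) *
      (2 * pair (coeff (g' t)) (coeff (g t)) K) := fun K => by
    funext t
    simp only [hr]
    ring
  have ri : ∀ K, IntervalIntegrable (r K) volume 0 T := fun K => by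
    rw [hrw]
    exact (modes K).1.const_mul _
  have rint : ∀ K, ∫ t in (0 : ℝ)..T, r K t
      = (1 + γ ^ 2 * eigen L K) * (amp (g T) K - amp (g 0) K) := fun K => by
    rw [hrw, intervalIntegral.integral_const_mul, (modes K).2]
  -- `B` dominates all partial sums of the energy rate; the Poincaré inequality bounds `‖g‖` by `‖A g‖`
  set B : ℝ → ℝ := fun t => (‖g' t‖ ^ 2 + (2 / lam1 L ^ 2 + 2 * γ ^ 4) * b t) / L ^ 3 with hB
  have hBi : IntegrableOn B (Set.Icc 0 T) :=
    ((hg'.integrable_norm_pow (by norm_num)).add (hb.const_mul _)).div_const _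
  have dom : ∀ᵐ t ∂(volume.restrict (Set.Icc 0 T)), Summable (fun K => r K t) ∧
      ∀ S : Finset (Fin 3 → ℤ), ‖∑ K ∈ S, r K t‖ ≤ B t := by
    filter_upwards [hDA] with t ht
    have k1 := hasSum_normSq_coeff hL (g' t)
    have k2 := ht.1.hasSum_eigen hL (s' := 0) zero_le_two
    have k3 := ht.1.hasSum_eigen hL (s' := 2) le_rfl
    simp only [pow_zero, one_mul] at k2
    have k4 := k1.add ((k2.mul_left 2).add (k3.mul_left (2 * γ ^ 4)))
    have k5 := fun K => abs_weighted_pair_le γ (g' t) (g t) K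
    refine ⟨Summable.of_norm_bounded k4.summable k5, fun S => ?_⟩
    refine (norm_sum_le_of_le S fun K _ => k5 K).trans ?_
    refine (sum_le_hasSum S (fun K _ => (abs_nonneg _).trans (k5 K)) k4).trans ?_
    have p1 := (ht.1.of_le one_le_two).lam1_mul_hNorm_sq_le hL (s := 0)
    have p2 := ht.1.lam1_mul_hNorm_sq_le hL (s := 1)
    have hl := lam1_pos hL
    have p3 : hNorm 0 (g t) ^ 2 ≤ b t / lam1 L ^ 2 := by
      rw [le_div_iff₀ (by positivity)]
      calc hNorm 0 (g t) ^ 2 * lam1 L ^ 2 = lam1 L * (lam1 L * hNorm 0 (g t) ^ 2) := by ring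
        _ ≤ lam1 L * hNorm (0 + 1) (g t) ^ 2 := mul_le_mul_of_nonneg_left p1 hl.le
        _ ≤ hNorm (1 + 1) (g t) ^ 2 := p2
        _ ≤ b t := ht.2
    have p4 : γ ^ 4 * hNorm 2 (g t) ^ 2 ≤ γ ^ 4 * b t :=
      mul_le_mul_of_nonneg_left ht.2 (by positivity)
    have e : ‖g' t‖ ^ 2 / L ^ 3 + (2 * (hNorm 0 (g t) ^ 2 / L ^ 3)
        + 2 * γ ^ 4 * (hNorm 2 (g t) ^ 2 / L ^ 3))
        = (‖g' t‖ ^ 2 + (2 * hNorm 0 (g t) ^ 2 + 2 * (γ ^ 4 * hNorm 2 (g t) ^ 2))) / L ^ 3 := by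
      ring
    rw [e]
    refine div_le_div_of_nonneg_right ?_ hL3.le
    have e2 : (2 / lam1 L ^ 2 + 2 * γ ^ 4) * b t = 2 * (b t / lam1 L ^ 2) + 2 * (γ ^ 4 * b t) := by
      ring
    rw [e2]
    linarith
  have hmeas : ∀ S : Finset (Fin 3 → ℤ),
      AEStronglyMeasurable (fun t => ∑ K ∈ S, r K t) (volume.restrict (Set.Icc 0 T)) := fun S =>
    Finset.aestronglyMeasurable_fun_sum S fun K _ =>
      ((intervalIntegrable_iff_integrableOn_Icc_of_le hT).1 (ri K)).1
  have lim : ∀ᵐ t ∂(volume.restrict (Set.Icc 0 T)),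
      Tendsto (fun S : Finset (Fin 3 → ℤ) => ∑ K ∈ S, r K t) atTop (𝓝 (∑' K, r K t)) := by
    filter_upwards [dom] with t ht using ht.1.hasSum
  have hDi : IntegrableOn (fun t => ∑' K, r K t) (Set.Icc 0 T) := by
    refine Integrable.mono' hBi (aestronglyMeasurable_of_tendsto_ae atTop hmeas lim) ?_
    filter_upwards [dom, lim] with t h1 h2
    exact le_of_tendsto' h2.norm h1.2
  have hDi' := (intervalIntegrable_iff_integrableOn_Icc_of_le hT).2 hDi
  have c1 : Tendsto (fun S : Finset (Fin 3 → ℤ) => ∫ t in Set.Icc 0 T, ∑ K ∈ S, r K t) atTop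
      (𝓝 (∫ t in Set.Icc 0 T, ∑' K, r K t)) :=
    tendsto_integral_filter_of_dominated_convergence B (Eventually.of_forall hmeas)
      (Eventually.of_forall fun S => dom.mono fun t ht => ht.2 S) hBi lim
  have c2 : ∀ S : Finset (Fin 3 → ℤ), ∫ t in Set.Icc 0 T, ∑ K ∈ S, r K t
      = ∑ K ∈ S, (1 + γ ^ 2 * eigen L K) * (amp (g T) K - amp (g 0) K) := fun S => by
    rw [integral_Icc_eq_integral_Ioc, ← intervalIntegral.integral_of_le hT,
      intervalIntegral.integral_finsetSum fun K _ => ri K]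
    exact Finset.sum_congr rfl fun K _ => rint K
  simp only [c2] at c1
  have en : ∀ t, 0 ≤ t → HasSum (fun K => (1 + γ ^ 2 * eigen L K) * amp (g t) K)
      ((‖g t‖ ^ 2 + γ ^ 2 * hNorm 1 (g t) ^ 2) / L ^ 3) := fun t ht => by
    have k1 := hasSum_normSq_coeff hL (g t)
    have k2 := (hV t ht).hasSum_eigen hL (s' := 1) le_rfl
    rw [add_div, mul_div_assoc]
    refine (k1.add (k2.mul_left (γ ^ 2))).congr_fun fun K => ?_
    rw [pow_one]
    change _ = amp (g t) K + _
    ring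
  have c3 := ((en T hT).sub (en 0 le_rfl))
  simp only [← mul_sub] at c3
  have c4 := tendsto_nhds_unique c1 c3
  rw [integral_Icc_eq_integral_Ioc, ← intervalIntegral.integral_of_le hT] at c4
  refine ⟨hDi'.const_mul (L ^ 3), ?_⟩
  have c5 : ∫ t in (0 : ℝ)..T, energyRate γ (g' t) (g t)
      = L ^ 3 * ∫ t in (0 : ℝ)..T, ∑' K, r K t := by
    rw [← intervalIntegral.integral_const_mul]
    rfl
  rw [c5, c4]
  field_simp
  ring

/-! ### The Bardina model and the nudged system -/

theorem IsRegular.energy_identity (hL : 0 < L) (γ : ℝ) {u u' : ℝ → L2 L} (hu : IsRegular u u')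
    {T : ℝ} (hT : 0 ≤ T) :
    IntervalIntegrable (fun t => energyRate γ (u' t) (u t)) volume 0 T ∧
      ‖u T‖ ^ 2 + γ ^ 2 * hNorm 1 (u T) ^ 2 = ‖u 0‖ ^ 2 + γ ^ 2 * hNorm 1 (u 0) ^ 2
        + ∫ t in (0 : ℝ)..T, energyRate γ (u' t) (u t) := by
  have hsub : Set.Icc 0 T ⊆ Set.Icc 0 (T + 1) := Set.Icc_subset_Icc_right (by linarith)
  refine Bardina.energy_identity hL γ hT hu.mem_V ?_
    ((hu.integrable_DA (T + 1) (by linarith)).mono_set hsub)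
    ((hu.deriv_memLp (T + 1) (by linarith)).mono_measure (Measure.restrict_mono hsub le_rfl))
    hu.eq_integral
  filter_upwards [ae_restrict_of_ae_restrict_of_subset Set.Icc_subset_Ici_self hu.mem_DA] with t ht
  exact ⟨ht, le_rfl⟩

/-- The energy identity for the difference of two fields of the regularity class. -/
theorem IsRegular.energy_identity_sub (hL : 0 < L) (γ : ℝ) {u u' w w' : ℝ → L2 L}
    (hu : IsRegular u u') (hw : IsRegular w w') {T : ℝ} (hT : 0 ≤ T) :
    IntervalIntegrable (fun t => energyRate γ (w' t - u' t) (w t - u t)) volume 0 T ∧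
      ‖w T - u T‖ ^ 2 + γ ^ 2 * hNorm 1 (w T - u T) ^ 2
        = ‖w 0 - u 0‖ ^ 2 + γ ^ 2 * hNorm 1 (w 0 - u 0) ^ 2
        + ∫ t in (0 : ℝ)..T, energyRate γ (w' t - u' t) (w t - u t) := by
  have hT1 : 0 < T + 1 := by linarith
  have hsub : Set.Icc 0 T ⊆ Set.Icc 0 (T + 1) := Set.Icc_subset_Icc_right (by linarith)
  refine Bardina.energy_identity hL γ (g := fun t => w t - u t) (g' := fun t => w' t - u' t)
    (b := fun t => 2 * hNorm 2 (w t) ^ 2 + 2 * hNorm 2 (u t) ^ 2) hT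
    (fun t ht => (hw.mem_V t ht).sub (hu.mem_V t ht)) ?_ ?_ ?_ ?_
  · filter_upwards [ae_restrict_of_ae_restrict_of_subset Set.Icc_subset_Ici_self hu.mem_DA,
      ae_restrict_of_ae_restrict_of_subset Set.Icc_subset_Ici_self hw.mem_DA] with t h1 h2
    exact ⟨h2.sub h1, h2.hNorm_sub_sq_le hL h1⟩
  · have hb : IntegrableOn (fun t => 2 * hNorm 2 (w t) ^ 2 + 2 * hNorm 2 (u t) ^ 2)
        (Set.Icc 0 (T + 1)) :=
      ((hw.integrable_DA (T + 1) hT1).const_mul 2).add ((hu.integrable_DA (T + 1) hT1).const_mul 2)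
    exact hb.mono_set hsub
  · exact ((hw.deriv_memLp (T + 1) hT1).sub (hu.deriv_memLp (T + 1) hT1)).mono_measure
      (Measure.restrict_mono hsub le_rfl)
  · intro t ht
    have ii : ∀ {v v' : ℝ → L2 L}, IsRegular v v' → IntervalIntegrable v' volume 0 t := fun hv =>
      (intervalIntegrable_iff_integrableOn_Icc_of_le ht).2
        (((hv.deriv_memLp (t + 1) (by linarith)).mono_measure (Measure.restrict_mono
          (Set.Icc_subset_Icc_right (by linarith)) le_rfl)).integrable (by norm_num))
    rw [intervalIntegral.integral_sub (ii hw) (ii hu), hw.eq_integral t ht, hu.eq_integral t ht]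
    abel

theorem IsForcing.ae_norm_sq_le {f : ℝ → L2 L} (hf : IsForcing f) :
    ∀ᵐ t ∂(volume.restrict (Set.Ici (0 : ℝ))), ‖f t‖ ^ 2 ≤ supSq f := by
  filter_upwards [ae_le_eLpNormEssSup (f := f) (μ := volume.restrict (Set.Ici (0 : ℝ)))] with t ht
  rw [← eLpNorm_exponent_top] at ht
  have := ENNReal.toReal_mono hf.1.2.ne ht
  rw [toReal_enorm] at this
  exact pow_le_pow_left₀ (norm_nonneg _) this 2

theorem supSq_nonneg (f : ℝ → L2 L) : 0 ≤ supSq f := sq_nonneg _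

/-- The energy of a solution of the simplified Bardina model decays up to the forcing. -/
theorem ae_bardina_energyRate_le (hL : 0 < L) {ν α : ℝ} (hν : 0 < ν) {f u u' : ℝ → L2 L}
    (hf : IsForcing f) (hu : IsRegular u u')
    (heq : ∀ᵐ t ∂(volume.restrict (Set.Ici (0 : ℝ))),
      helmholtz L α (coeff (u' t)) + (ν : ℂ) • stokes L (helmholtz L α (coeff (u t)))
        + bilin (u t) (u t) = coeff (f t)) :
    ∀ᵐ t ∂(volume.restrict (Set.Ici (0 : ℝ))), energyRate α (u' t) (u t)
      ≤ -ν * (hNorm 1 (u t) ^ 2 + α ^ 2 * hNorm 2 (u t) ^ 2) + supSq f / (ν * lam1 L) := by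
  filter_upwards [heq, hu.mem_DA, hf.ae_norm_sq_le] with t h1 h2 h3
  have e := (hasSum_energy_bardina hL h2 h1).mul_left 2
  have e2 : energyRate α (u' t) (u t) = 2 * (inner ℝ (f t) (u t)
      - ν * (hNorm 1 (u t) ^ 2 + α ^ 2 * hNorm 2 (u t) ^ 2)) := by
    have hL3 : L ^ 3 ≠ 0 := by positivity
    unfold energyRate
    simp only [← mul_assoc] at e
    rw [e.tsum_eq]
    field_simp
  rw [e2]
  refine bardina_dissipation hν (lam1_pos hL) (real_inner_le_norm _ _) h3 ?_
  rw [← hNorm_zero hL]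
  exact (h2.of_le one_le_two).lam1_mul_hNorm_sq_le hL

/-- The a priori bound `‖u(t)‖² + α² ‖∇u(t)‖² ≤ M₁`. -/
theorem bardina_energy_le (hL : 0 < L) {ν α : ℝ} (hν : 0 < ν) {f u u' : ℝ → L2 L}
    (hf : IsForcing f) (hu : IsRegular u u')
    (heq : ∀ᵐ t ∂(volume.restrict (Set.Ici (0 : ℝ))),
      helmholtz L α (coeff (u' t)) + (ν : ℂ) • stokes L (helmholtz L α (coeff (u t)))
        + bilin (u t) (u t) = coeff (f t)) {t : ℝ} (ht : 0 ≤ t) :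
    ‖u t‖ ^ 2 + α ^ 2 * hNorm 1 (u t) ^ 2 ≤ M1 ν α f (u 0) := by
  have hl := lam1_pos hL
  have h := gronwall_of_integral (E := fun t => ‖u t‖ ^ 2 + α ^ 2 * hNorm 1 (u t) ^ 2)
    (e := fun t => energyRate α (u' t) (u t)) (κ := ν * lam1 L) (C := supSq f / (ν * lam1 L))
    (by positivity) (fun T hT => (hu.energy_identity hL α hT).1)
    (fun T hT => (hu.energy_identity hL α hT).2) (by
      filter_upwards [ae_bardina_energyRate_le hL hν hf hu heq, hu.mem_DA] with t h1 h2
      refine h1.trans ?_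
      have p1 := (h2.of_le one_le_two).lam1_mul_hNorm_sq_le hL (s := 0)
      have p2 := h2.lam1_mul_hNorm_sq_le hL (s := 1)
      rw [hNorm_zero hL] at p1
      have p3 := mul_le_mul_of_nonneg_left p1 hν.le
      have p4 := mul_le_mul_of_nonneg_left p2 (show 0 ≤ ν * α ^ 2 by positivity)
      simp only [zero_add, Nat.reduceAdd] at p3 p4
      linarith) ht
  have hS := supSq_nonneg f
  have hE : 0 ≤ ‖u 0‖ ^ 2 + α ^ 2 * hNorm 1 (u 0) ^ 2 := by positivity
  have he0 := Real.exp_pos (-(ν * lam1 L) * t)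
  have he1 : Real.exp (-(ν * lam1 L) * t) ≤ 1 := by
    rw [Real.exp_le_one_iff, neg_mul]
    have : 0 ≤ ν * lam1 L * t := by positivity
    linarith
  have hC : 0 ≤ supSq f / (ν * lam1 L) / (ν * lam1 L) := by positivity
  have e : 1 / (lam1 L ^ 2 * ν ^ 2) * supSq f = supSq f / (ν * lam1 L) / (ν * lam1 L) := by
    field_simp
  unfold M1
  rw [e]
  nlinarith

/-- The energy of the difference of the two solutions decays up to the model error. -/
theorem ae_difference_energyRate_le (hL : 0 < L) {ν α β η h c κ c₁ c₂ M : ℝ} (hν : 0 < ν)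
    (hα : 0 < α) (hβ : 0 < β) (hc : QuarticBound L (c ^ 4)) (hκ : QuarticBound L κ)
    (hκc : κ ^ 2 ≤ 27 * c ^ 4) {Ih : L2 L →ₗ[ℝ] L2 L} (hIh : IsInterpolant h c₁ c₂ Ih)
    {f u u' w w' : ℝ → L2 L} (hf : IsForcing f) (hu : IsRegular u u') (hw : IsRegular w w')
    (hequ : ∀ᵐ t ∂(volume.restrict (Set.Ici (0 : ℝ))),
      helmholtz L α (coeff (u' t)) + (ν : ℂ) • stokes L (helmholtz L α (coeff (u t)))
        + bilin (u t) (u t) = coeff (f t))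
    (heqw : ∀ᵐ t ∂(volume.restrict (Set.Ici (0 : ℝ))),
      helmholtz L β (coeff (w' t)) + (ν : ℂ) • stokes L (helmholtz L β (coeff (w t)))
        + bilin (w t) (w t) = coeff (f t) - (η : ℂ) • leray (coeff (Ih (w t) - Ih (u t))))
    (hM : ∀ t, 0 ≤ t → ‖u t‖ ^ 2 + α ^ 2 * hNorm 1 (u t) ^ 2 ≤ M)
    (hη : 27 * c ^ 4 / 16 * (3 / ν) ^ 3 * (M ^ 2 / α ^ 4) < η)
    (hh₁ : 2 * η * c₁ * h ^ 2 < ν) (hh₂ : 2 * η * c₂ * h ^ 4 < ν * β ^ 2) :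
    ∀ᵐ t ∂(volume.restrict (Set.Ici (0 : ℝ))), energyRate β (w' t - u' t) (w t - u t)
      ≤ -(lam1 L * ν / 2) * (‖w t - u t‖ ^ 2 + β ^ 2 * hNorm 1 (w t - u t) ^ 2)
        + (β ^ 2 - α ^ 2) ^ 2 / β ^ 2 * (2 * supSq f / ν
          + 3 / 8 * (ν * hNorm 1 (u t) ^ 2 / α ^ 2)
          + 1 / 8 * (c ^ 16 * M ^ 5 / (ν ^ 7 * α ^ 8))) := by
  have hpos : ∀ᵐ t ∂(volume.restrict (Set.Ici (0 : ℝ))), 0 ≤ t :=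
    (ae_restrict_iff' measurableSet_Ici).2 (Eventually.of_forall fun t ht => ht)
  filter_upwards [hequ, heqw, hu.mem_DA, hw.mem_DA, hf.ae_norm_sq_le, hpos]
    with t h1 h2 hut hwt hft ht
  have hg : MemV L 2 (w t - u t) := hwt.sub hut
  obtain ⟨hTu, hQu⟩ := hc (u t) (hu.mem_V t ht)
  obtain ⟨hTg, hQg⟩ := hκ (w t - u t) (hg.of_le one_le_two)
  obtain ⟨d, hd, hd'⟩ := hasSum_energy_difference hL hα hut hwt hg hTu hTg h1 h2
  set g := w t - u t with hgdef
  have hQ0 : ∀ v : L2 L, 0 ≤ L ^ 3 * ∑' K, tensorSq v K := fun v =>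
    mul_nonneg (by positivity) (tsum_nonneg fun K => tensorSq_nonneg v K)
  have hMt := hM t ht
  have hW : 0 ≤ 2 * ‖f t‖ ^ 2 + (L ^ 3 * ∑' K, tensorSq (u t) K) / (2 * α ^ 2) := by
    have := hQ0 (u t)
    positivity
  have hip : ‖g‖ ^ 2 / 2 - (c₁ * h ^ 2 * hNorm 1 g ^ 2 + c₂ * h ^ 4 * hNorm 2 g ^ 2) / 2
      ≤ inner ℝ (Ih (w t) - Ih (u t)) g := by
    have k1 := hIh g hg
    rw [← map_sub, ← hgdef]
    have k2 : inner ℝ (Ih g) g = inner ℝ (Ih g - g) g + ‖g‖ ^ 2 := by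
      rw [inner_sub_left, real_inner_self_eq_norm_sq]
      ring
    have k3 := neg_le_of_abs_le (abs_real_inner_le_norm (Ih g - g) g)
    nlinarith [sq_nonneg (‖Ih g - g‖ - ‖g‖)]
  have p1 := (hg.of_le one_le_two).lam1_mul_hNorm_sq_le hL (s := 0)
  have p2 := hg.lam1_mul_hNorm_sq_le hL (s := 1)
  rw [hNorm_zero hL] at p1
  have key := difference_dissipation hν hα hβ hκc (hNorm_nonneg 1 (u t)) (hQ0 g) hQg
    (by nlinarith [sq_nonneg ‖u t‖]) hW hη hh₁ hh₂ p1 p2 hip hd'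
  have e : energyRate β (w' t - u' t) g = 2 * (L ^ 3 * d) := by
    have := (hd.mul_left 2).tsum_eq
    unfold energyRate
    simp only [← mul_assoc] at this
    rw [this]
    ring
  rw [e]
  refine key.trans (add_le_add le_rfl ?_)
  have e2 : (β ^ 2 - α ^ 2) ^ 2 / (ν * β ^ 2) *
      (2 * ‖f t‖ ^ 2 + (L ^ 3 * ∑' K, tensorSq (u t) K) / (2 * α ^ 2))
      = (β ^ 2 - α ^ 2) ^ 2 / β ^ 2 *
      ((2 * ‖f t‖ ^ 2 + (L ^ 3 * ∑' K, tensorSq (u t) K) / (2 * α ^ 2)) / ν) := by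
    field_simp
  rw [e2]
  exact mul_le_mul_of_nonneg_left
    (model_error_le hν hα (norm_nonneg _) (hNorm_nonneg 1 _) hMt hft hQu) (by positivity)

/-- The constants that result from the Grönwall inequality are dominated by `M₂`. -/
theorem accumulated_error_le {ν α c M S lam E : ℝ} (hν : 0 < ν) (hα : 0 < α) (hlam : 0 < lam)
    (hS : 0 ≤ S) (hE : E ≤ M) (hM : 0 ≤ M) :
    3 / 4 / α ^ 2 * E + (2 * S / ν + 3 / 4 / α ^ 2 * (S / (ν * lam))
        + 1 / 8 * (c ^ 16 * M ^ 5 / (ν ^ 7 * α ^ 8))) / (lam * ν / 2)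
      ≤ 2 * Real.exp 1 / (Real.exp (1 / 2) - 1) * (7 * M / α ^ 2
        + 81 / 256 * (c ^ 16 * M ^ 5 / (ν ^ 8 * α ^ 8 * lam))
        + (1 / (ν ^ 2 * lam) + 3 / (ν ^ 2 * lam ^ 2 * α ^ 2)) * S) := by
  -- `2 e / (e^{1/2} - 1) ≥ 4` because `(e^{1/2} - 1)² + 1 ≥ 0`
  have hK : 4 ≤ 2 * Real.exp 1 / (Real.exp (1 / 2) - 1) := by
    have h1 : Real.exp 1 = Real.exp (1 / 2) ^ 2 := by
      rw [← Real.exp_nat_mul]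
      norm_num
    have h2 : 0 < Real.exp (1 / 2) - 1 := by
      have : (1 : ℝ) < Real.exp (1 / 2) := Real.one_lt_exp_iff.2 (by norm_num)
      linarith
    rw [le_div_iff₀ h2, h1]
    nlinarith [sq_nonneg (Real.exp (1 / 2) - 1)]
  have hq : 0 ≤ c ^ 16 * M ^ 5 / (ν ^ 8 * α ^ 8 * lam) := by positivity
  have hM2 : 0 ≤ 7 * M / α ^ 2 + 81 / 256 * (c ^ 16 * M ^ 5 / (ν ^ 8 * α ^ 8 * lam))
        + (1 / (ν ^ 2 * lam) + 3 / (ν ^ 2 * lam ^ 2 * α ^ 2)) * S := by positivity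
  refine le_trans ?_ (mul_le_mul_of_nonneg_right hK hM2)
  have hE' : 3 / 4 / α ^ 2 * E ≤ 3 / 4 / α ^ 2 * M := by gcongr
  have e : (2 * S / ν + 3 / 4 / α ^ 2 * (S / (ν * lam))
        + 1 / 8 * (c ^ 16 * M ^ 5 / (ν ^ 7 * α ^ 8))) / (lam * ν / 2)
      = 4 * (1 / (ν ^ 2 * lam) * S) + 3 / 2 * (1 / (ν ^ 2 * lam ^ 2 * α ^ 2) * S)
        + 1 / 4 * (c ^ 16 * M ^ 5 / (ν ^ 8 * α ^ 8 * lam)) := by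
    field_simp
    ring
  have h3 : 0 ≤ 1 / (ν ^ 2 * lam ^ 2 * α ^ 2) * S := by positivity
  have h4 : 0 ≤ M / α ^ 2 := by positivity
  have e2 : 3 / 4 / α ^ 2 * M = 3 / 4 * (M / α ^ 2) := by ring
  have e3 : 4 * (7 * M / α ^ 2 + 81 / 256 * (c ^ 16 * M ^ 5 / (ν ^ 8 * α ^ 8 * lam))
        + (1 / (ν ^ 2 * lam) + 3 / (ν ^ 2 * lam ^ 2 * α ^ 2)) * S)
      = 28 * (M / α ^ 2) + 81 / 64 * (c ^ 16 * M ^ 5 / (ν ^ 8 * α ^ 8 * lam))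
        + 4 * (1 / (ν ^ 2 * lam) * S) + 12 * (1 / (ν ^ 2 * lam ^ 2 * α ^ 2) * S) := by
    ring
  rw [e, e3]
  linarith

end

end Bardina

open Bardina
theorem theorem3p1 (L ν α β η h c c₁ c₂ : ℝ)
    (hL : 0 < L) (hν : 0 < ν) (hα : 0 < α) (hβ : 0 < β) (hh : 0 < h)
    (hc : 0 < c) (hc₁ : 0 < c₁) (hc₂ : 0 < c₂)
    (hGN : IsGNConstant L c)
    (f : ℝ → L2 L) (hf : IsForcing f)
    (Ih : L2 L →ₗ[ℝ] L2 L) (hIh : IsInterpolant h c₁ c₂ Ih)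
    (u₀ w₀ : L2 L) (hu₀ : MemV L 1 u₀) (hw₀ : MemV L 1 w₀)
    (u w : ℝ → L2 L)
    (hu : IsBardinaSolution ν α f u₀ u)
    (hw : IsNudgedSolution ν β η f Ih u w₀ w)
    (hη : 27 * c ^ 4 / 16 * (3 / ν) ^ 3 * (M1 ν α f u₀ ^ 2 / α ^ 4) < η)
    (hh₁ : 2 * η * c₁ * h ^ 2 < ν) (hh₂ : 2 * η * c₂ * h ^ 4 < ν * β ^ 2) :
    ∀ t : ℝ, 0 ≤ t →
      ‖w t - u t‖ ^ 2 + β ^ 2 * hNorm 1 (w t - u t) ^ 2 ≤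
        Real.exp (-(lam1 L * ν / 2) * t)
            * (‖w 0 - u 0‖ ^ 2 + β ^ 2 * hNorm 1 (w 0 - u 0) ^ 2)
          + 2 * Real.exp 1 / (Real.exp (1 / 2) - 1)
            * (|β ^ 2 - α ^ 2| ^ 2 / β ^ 2) * M2 ν α c f u₀ := by
  obtain ⟨hu0, u', hur, hueq⟩ := hu
  obtain ⟨-, w', hwr, hweq⟩ := hw
  have hl := lam1_pos hL
  have hS := supSq_nonneg f
  have hQc := hGN.quarticBound hL hc
  have hM : ∀ t, 0 ≤ t → ‖u t‖ ^ 2 + α ^ 2 * hNorm 1 (u t) ^ 2 ≤ M1 ν α f u₀ := fun t ht => by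
    rw [← hu0]
    exact bardina_energy_le hL hν hf hur hueq ht
  have hM0 : 0 ≤ M1 ν α f u₀ := le_trans (by positivity) (hM 0 le_rfl)
  -- the trilinear term costs `κ²` in place of `c⁴` in the condition on `η`: for large `c` the
  -- constant `27`, which needs no hypothesis, takes over
  obtain ⟨κ, hκ, hκc⟩ : ∃ κ, QuarticBound L κ ∧ κ ^ 2 ≤ 27 * c ^ 4 := by
    have h4 : 0 < c ^ 4 := by positivity
    rcases le_total (c ^ 4) 27 with h27 | h27
    · exact ⟨c ^ 4, hQc, by nlinarith⟩
    · exact ⟨27, quarticBound_twentySeven hL, by nlinarith⟩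
  have hrate := ae_difference_energyRate_le hL hν hα hβ hQc hκ hκc hIh hf hur hwr hueq hweq hM hη
    hh₁ hh₂
  have hrate' := ae_bardina_energyRate_le hL hν hf hur hueq
  intro t ht
  set D := (β ^ 2 - α ^ 2) ^ 2 / β ^ 2 with hD
  have hD0 : 0 ≤ D := by positivity
  set M := M1 ν α f u₀ with hMdef
  set S := supSq f with hSdef
  set C := 2 * S / ν + 3 / 4 / α ^ 2 * (S / (ν * lam1 L))
        + 1 / 8 * (c ^ 16 * M ^ 5 / (ν ^ 7 * α ^ 8)) with hC
  have hC0 : 0 ≤ C := by positivity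
  set ρ := D * (3 / 4 / α ^ 2) with hρ
  have hρ0 : 0 ≤ ρ := by positivity
  -- a multiple of the Bardina energy is added, whose dissipation absorbs the part of the model
  -- error that is not bounded by a constant
  have key := gronwall_of_integral
    (E := fun t => (‖w t - u t‖ ^ 2 + β ^ 2 * hNorm 1 (w t - u t) ^ 2)
      + ρ * (‖u t‖ ^ 2 + α ^ 2 * hNorm 1 (u t) ^ 2))
    (e := fun t => energyRate β (w' t - u' t) (w t - u t) + ρ * energyRate α (u' t) (u t))
    (κ := lam1 L * ν / 2) (C := D * C) (by positivity)
    (fun T hT => (hur.energy_identity_sub hL β hwr hT).1.add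
      ((hur.energy_identity hL α hT).1.const_mul ρ))
    (fun T hT => by
      have i1 := hur.energy_identity_sub hL β hwr hT
      have i2 := hur.energy_identity hL α hT
      rw [intervalIntegral.integral_add i1.1 (i2.1.const_mul ρ),
        intervalIntegral.integral_const_mul]
      linear_combination i1.2 + ρ * i2.2)
    (by
      filter_upwards [hrate, hrate', hur.mem_DA] with s r1 r2 hs
      have p1 := (hs.of_le one_le_two).lam1_mul_hNorm_sq_le hL (s := 0)
      have p2 := hs.lam1_mul_hNorm_sq_le hL (s := 1)
      rw [hNorm_zero hL] at p1
      simp only [zero_add, Nat.reduceAdd] at p1 p2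
      have p3 := mul_le_mul_of_nonneg_left p1 (show 0 ≤ ν / 2 by positivity)
      have p4 := mul_le_mul_of_nonneg_left p2 (show 0 ≤ ν / 2 * α ^ 2 by positivity)
      have r3 : energyRate α (u' s) (u s) ≤ -(lam1 L * ν / 2) * (‖u s‖ ^ 2
          + α ^ 2 * hNorm 1 (u s) ^ 2) - ν / 2 * hNorm 1 (u s) ^ 2 + S / (ν * lam1 L) := by
        have : 0 ≤ ν / 2 * (α ^ 2 * hNorm 2 (u s) ^ 2) := by positivity
        linarith
      have r4 := mul_le_mul_of_nonneg_left r3 hρ0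
      have e : D * C = D * (2 * S / ν + 3 / 8 * (ν * hNorm 1 (u s) ^ 2 / α ^ 2)
          + 1 / 8 * (c ^ 16 * M ^ 5 / (ν ^ 7 * α ^ 8)))
          + ρ * (-(ν / 2 * hNorm 1 (u s) ^ 2) + S / (ν * lam1 L)) := by
        rw [hC, hρ]
        field_simp
        ring
      rw [e]
      linarith) ht
  have hexp0 := Real.exp_pos (-(lam1 L * ν / 2) * t)
  have hexp1 : Real.exp (-(lam1 L * ν / 2) * t) ≤ 1 := by
    rw [Real.exp_le_one_iff, neg_mul]
    have : 0 ≤ lam1 L * ν / 2 * t := by positivity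
    linarith
  have hfin := accumulated_error_le (c := c) hν hα hl hS (hM 0 le_rfl) hM0
  have hfin' := mul_le_mul_of_nonneg_left hfin hD0
  have hM2 : M2 ν α c f u₀ = 7 * M / α ^ 2
        + 81 / 256 * (c ^ 16 * M ^ 5 / (ν ^ 8 * α ^ 8 * lam1 L))
        + (1 / (ν ^ 2 * lam1 L) + 3 / (ν ^ 2 * lam1 L ^ 2 * α ^ 2)) * S := rfl
  rw [sq_abs, ← hD, hM2]
  have hu_nonneg : 0 ≤ ρ * (‖u t‖ ^ 2 + α ^ 2 * hNorm 1 (u t) ^ 2) := by positivity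
  have h1 : Real.exp (-(lam1 L * ν / 2) * t) * (ρ * (‖u 0‖ ^ 2 + α ^ 2 * hNorm 1 (u 0) ^ 2))
      ≤ ρ * (‖u 0‖ ^ 2 + α ^ 2 * hNorm 1 (u 0) ^ 2) :=
    mul_le_of_le_one_left (by positivity) hexp1
  have h2 : D * C / (lam1 L * ν / 2) * (1 - Real.exp (-(lam1 L * ν / 2) * t))
      ≤ D * (C / (lam1 L * ν / 2)) := by
    rw [mul_div_assoc]
    exact mul_le_of_le_one_right (by positivity) (by linarith)
  rw [← hC] at hfin'
  have e5 : ρ * (‖u 0‖ ^ 2 + α ^ 2 * hNorm 1 (u 0) ^ 2)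
      = D * (3 / 4 / α ^ 2 * (‖u 0‖ ^ 2 + α ^ 2 * hNorm 1 (u 0) ^ 2)) := by
    rw [hρ]; ring
  linarith
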